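/- Let $X$ be a scheme, and let $X/\mathbf{Sch}_X$ be the category of $X$-schemes $p\colon Y\to X$ equipped with a section $\sigma\colon X\to Y$; its coproducts are the pushouts $-\amalg_X-$ in $\mathbf{Sch}_X$. A cogroup in $X/\mathbf{Sch}_X$ is a triple $(Y,c,\iota)$ such that $Y\amalg_X Y$ exists in $X/\mathbf{Sch}_X$, with a comultiplication $c\colon Y\to Y\amalg_X Y$ and an inversion $\iota\colon Y\to Y$ in $X/\mathbf{Sch}_X$ satisfying the cogroup axioms (that is, for every $T$ in $X/\mathbf{Sch}_X$ the operation $f*g=[f,g]\circ c$ on the set $\mathrm{Hom}(Y,T)$ is a group law with neutral element $Y\to X\to T$ and inverse $f\mapsto f\circ\iota$). For a quasi-coherent $\mathcal O_X$-module $\mathscr F$ let $\mathrm{Nil}_X(\mathscr F)=\mathbf{Spec}_X(\mathcal O_X\oplus\mathscr F)$, where $\mathcal O_X\oplus\mathscr F=\mathrm{Sym}^*\mathscr F/\mathrm{Sym}^{\ge 2}\mathscr F$ (so $\mathscr F$ squares to zero), with the section $X\to \mathrm{Nil}_X(\mathscr F)$ given by the projection $\mathcal O_X\oplus\mathscr F\to\mathcal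 O_X$. Its standard cogroup structure has $\mathrm{Nil}_X(\mathscr F)\amalg_X\mathrm{Nil}_X(\mathscr F)=\mathrm{Nil}_X(\mathscr F\oplus\mathscr F)$ (with coproduct inclusions induced by the two projections $\mathscr F\oplus\mathscr F\to\mathscr F$), comultiplication induced by the addition $\mathscr F\oplus\mathscr F\to\mathscr F$, and inversion induced by $-1\colon\mathscr F\to\mathscr F$. Let $(Y,c,\iota)$ be a cogroup in $X/\mathbf{Sch}_X$ such that the underlying set of $Y\amalg_X Y$ is the pushout of sets $|Y|\amalg_{|X|}|Y|$ (via the canonical maps). Then: 1. There is a quasi-coherent $\mathcal O_X$-module $\mathscr F$ and an isomorphism $(Y,c,\iota)\cong(\mathrm{Nil}_X(\mathscr F),c,\iota)$ of cogroups, that is, an isomorphism in $X/\mathbf{Sch}_X$ compatible with the comultiplications and the inversions. 2. The module $\mathscr F$ is unique up to unique isomorphism: if $e\colon (Y,c,\iota)\cong\mathrm{Nil}_X(\mathscr F)$ and $e'\colon (Y,c,\iota)\cong\mathrm{Nil}_X(\mathscr G)$ are two such isomorphisms, then there is a unique isomorphism $\varphi\colon\mathscr F\cong\mathscr G$ with $\mathrm{Nil}_X(\varphi)\circ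 e'=e$. 3. The structure morphism $p\colon Y\to X$ is a homeomorphism on underlying spaces and is affine, and the augmentation ideal $\mathscr I=\ker(\sigma^\#\colon p_*\mathcal O_Y\to\mathcal O_X)$ satisfies $\mathscr I^2=0$. -/

import Mathlib

open CategoryTheory Limits AlgebraicGeometry Opposite TopologicalSpace

universe u

noncomputable section

namespace AlgebraicGeometry.Scheme.Modules

variable {X : Scheme.{u}}

theorem appIso_fromSpec_inv {U : X.Opens} (hU : IsAffineOpen U) (V : (Spec Γ(X, U)).Opens)
    (h : hU.fromSpec ''ᵁ V ≤ U) (r : Γ(X, U)) :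
    (hU.fromSpec.appIso V).inv ((Spec Γ(X, U)).presheaf.map V.leTop.op
      ((Scheme.ΓSpecIso Γ(X, U)).inv r)) = X.presheaf.map (homOfLE h).op r := by
  have key : (Scheme.ΓSpecIso Γ(X, U)).inv ≫ (Spec Γ(X, U)).presheaf.map V.leTop.op ≫
      (hU.fromSpec.appIso V).inv = X.presheaf.map (homOfLE h).op := by
    rw [← Category.assoc, Iso.comp_inv_eq, Scheme.Hom.appIso_hom', Scheme.Hom.map_appLE,
      Scheme.Hom.appLE, hU.fromSpec_app_self]
    simp only [Category.assoc, ← Functor.map_comp]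
    rfl
  exact ConcreteCategory.congr_hom key r


theorem exists_map_eq_pow_smul_Spec {R : CommRingCat.{u}} (M : (Spec R).Modules) [M.IsQuasicoherent]
    (r : R) (V : (Spec R).Opens) (hV : V = PrimeSpectrum.basicOpen r) (s : Γ(M, V)) :
    ∃ (n : ℕ) (t : Γ(M, ⊤)), M.presheaf.map V.leTop.op t =
      (Spec R).presheaf.map V.leTop.op ((Scheme.ΓSpecIso R).inv (r ^ n)) • s := by
  subst hV
  have h := (isIso_fromTildeΓ_iff_isLocalizing M).mp inferInstance r
  obtain ⟨⟨t, ⟨_, n, rfl⟩⟩, hn⟩ := h.surj s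
  exact ⟨n, t, hn.symm⟩

theorem exists_pow_smul_eq_zero_Spec {R : CommRingCat.{u}} (M : (Spec R).Modules)
    [M.IsQuasicoherent] (r : R) (V : (Spec R).Opens) (hV : V = PrimeSpectrum.basicOpen r)
    (t : Γ(M, ⊤)) (ht : M.presheaf.map V.leTop.op t = 0) :
    ∃ n : ℕ, (Spec R).presheaf.map (⊤ : (Spec R).Opens).leTop.op
        ((Scheme.ΓSpecIso R).inv (r ^ n)) • t = 0 := by
  subst hV
  have h := (isIso_fromTildeΓ_iff_isLocalizing M).mp inferInstance r
  obtain ⟨⟨_, n, rfl⟩, hn⟩ := (IsLocalizedModule.eq_zero_iff (.powers r)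
    ((modulesSpecToSheaf.obj M).obj.map (Opens.leTop (X := Spec R)
      (PrimeSpectrum.basicOpen r)).op).hom (m := t)).mp ht
  exact ⟨n, hn⟩

/-- A section of a quasi-coherent module over `D(r) ⊆ U` extends to the affine open `U`
after multiplication by a power of `r`. -/
theorem exists_map_eq_pow_smul {F : X.Modules} [F.IsQuasicoherent] {U : X.Opens}
    (hU : IsAffineOpen U) (r : Γ(X, U)) (s : Γ(F, X.basicOpen r)) :
    ∃ (n : ℕ) (t : Γ(F, U)), F.presheaf.map (homOfLE (X.basicOpen_le r)).op t =
      X.presheaf.map (homOfLE (X.basicOpen_le r)).op (r ^ n) • s := by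
  obtain ⟨V, hV⟩ : ∃ V : (Spec Γ(X, U)).Opens, V = PrimeSpectrum.basicOpen r := ⟨_, rfl⟩
  have e₁ : hU.fromSpec ''ᵁ V = X.basicOpen r := by rw [hV, hU.fromSpec_image_basicOpen]
  have e₂ : hU.fromSpec ''ᵁ ⊤ = U := by simp
  have : (F.restrict hU.fromSpec).IsQuasicoherent :=
    isQuasicoherent_restrictFunctor hU.fromSpec F
  obtain ⟨n, (t : Γ(F, hU.fromSpec ''ᵁ ⊤)), ht⟩ := exists_map_eq_pow_smul_Spec (F.restrict hU.fromSpec) r V hV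
    (F.presheaf.map (eqToHom e₁).op s)
  change F.presheaf.map (homOfLE (hU.fromSpec.image_mono le_top)).op t =
    ((hU.fromSpec.appIso V).inv ((Spec Γ(X, U)).presheaf.map
      V.leTop.op
      ((Scheme.ΓSpecIso Γ(X, U)).inv (r ^ n)))) • F.presheaf.map (eqToHom e₁).op s at ht
  rw [appIso_fromSpec_inv hU _ (e₁.le.trans (X.basicOpen_le r))] at ht
  refine ⟨n, F.presheaf.map (eqToHom e₂.symm).op t, ?_⟩
  have := congr(F.presheaf.map (eqToHom e₁.symm).op $ht)
  rw [map_smul, ← ConcreteCategory.comp_apply, ← ConcreteCategory.comp_apply,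
    ← ConcreteCategory.comp_apply, ← Functor.map_comp, ← Functor.map_comp, ← Functor.map_comp] at this
  rw [← ConcreteCategory.comp_apply, ← Functor.map_comp]
  refine Eq.trans ?_ (this.trans ?_)
  · rfl
  · congr 1
    simp

/-- A section of a quasi-coherent module over an affine open `U` that vanishes on `D(r)` is
annihilated by a power of `r`. -/
theorem exists_pow_smul_eq_zero {F : X.Modules} [F.IsQuasicoherent] {U : X.Opens}
    (hU : IsAffineOpen U) (r : Γ(X, U)) (t : Γ(F, U))
    (ht : F.presheaf.map (homOfLE (X.basicOpen_le r)).op t = 0) :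
    ∃ n : ℕ, r ^ n • t = 0 := by
  obtain ⟨V, hV⟩ : ∃ V : (Spec Γ(X, U)).Opens, V = PrimeSpectrum.basicOpen r := ⟨_, rfl⟩
  have e₁ : hU.fromSpec ''ᵁ V = X.basicOpen r := by rw [hV, hU.fromSpec_image_basicOpen]
  have e₂ : hU.fromSpec ''ᵁ ⊤ = U := by simp
  have : (F.restrict hU.fromSpec).IsQuasicoherent :=
    isQuasicoherent_restrictFunctor hU.fromSpec F
  obtain ⟨n, hn⟩ := exists_pow_smul_eq_zero_Spec (F.restrict hU.fromSpec) r V hV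
    (F.presheaf.map (eqToHom e₂).op t) (by
      have := congr(F.presheaf.map (eqToHom e₁).op $ht)
      rw [map_zero, ← ConcreteCategory.comp_apply, ← Functor.map_comp] at this
      change F.presheaf.map (homOfLE _).op (F.presheaf.map (eqToHom e₂).op t) = 0
      rw [← ConcreteCategory.comp_apply, ← Functor.map_comp]
      exact this)
  change ((hU.fromSpec.appIso ⊤).inv ((Spec Γ(X, U)).presheaf.map
      (⊤ : (Spec Γ(X, U)).Opens).leTop.op ((Scheme.ΓSpecIso Γ(X, U)).inv (r ^ n)))) •
      F.presheaf.map (eqToHom e₂).op t = 0 at hn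
  rw [appIso_fromSpec_inv hU _ e₂.le] at hn
  refine ⟨n, ?_⟩
  have := congr(F.presheaf.map (eqToHom e₂.symm).op $hn)
  rw [map_smul, map_zero, ← ConcreteCategory.comp_apply, ← ConcreteCategory.comp_apply,
    ← Functor.map_comp, ← Functor.map_comp] at this
  simpa [← op_comp] using this

/-- A module that has a presentation over every affine open is quasi-coherent. -/
theorem isQuasicoherent_of_affine (F : X.Modules)
    (h : ∀ U : X.affineOpens, Nonempty (F.restrict U.1.ι).Presentation) : F.IsQuasicoherent := by
  have (U : X.affineOpens) : SheafOfModules.IsQuasicoherent.{u} (SheafOfModules.over.{u} F U.1) := by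
    obtain ⟨P⟩ := h U
    let e : SheafOfModules.{u} (X.ringCatSheaf.over U.1) ≌
        SheafOfModules.{u} U.1.toScheme.ringCatSheaf := overEquiv U.1
    let η : SheafOfModules.unit (X.ringCatSheaf.over U.1) ≅
        e.inverse.obj (.unit U.1.toScheme.ringCatSheaf) :=
      e.unitIso.app _ ≪≫ e.inverse.mapIso
        ((overFunctorEquiv U.1).app (.unit X.ringCatSheaf) ≪≫ restrictUnitIso U.1.ι)
    have : PreservesColimitsOfSize.{u, u} e.inverse := e.symm.toAdjunction.leftAdjoint_preservesColimits
    let P' := P.map e.inverse η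
    let i : e.inverse.obj (F.restrict U.1.ι) ≅ SheafOfModules.over.{u} F U.1 :=
       (e.inverse.mapIso ((overFunctorEquiv U.1).app F)).symm ≪≫ (e.unitIso.app _).symm
    exact (P'.ofIsIso i.hom).isQuasicoherent
  refine SheafOfModules.IsQuasicoherent.of_coversTop F (fun U : X.affineOpens ↦ U.1) ?_
  rw [Opens.coversTop_iff, IsOpenCover]
  exact iSup_affineOpens_eq_top X

/-- Direct sums of quasi-coherent modules are quasi-coherent. -/
instance biprod_isQuasicoherent (F G : X.Modules) [F.IsQuasicoherent] [G.IsQuasicoherent] :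
    (F ⊞ G).IsQuasicoherent := by
  refine isQuasicoherent_of_affine _ fun U ↦ ?_
  have hU : IsAffineOpen U.1 := U.2
  let ψ := hU.fromSpec
  have hM : (F.restrict ψ).IsQuasicoherent := isQuasicoherent_restrictFunctor ψ F
  have hN : (G.restrict ψ).IsQuasicoherent := isQuasicoherent_restrictFunctor ψ G
  have hM' : IsIso (F.restrict ψ).fromTildeΓ := isIso_fromTildeΓ_of_isQuasicoherent (F.restrict ψ)
  have hN' : IsIso (G.restrict ψ).fromTildeΓ := isIso_fromTildeΓ_of_isQuasicoherent (G.restrict ψ)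
  have : PreservesBinaryBiproducts (restrictFunctor ψ) :=
    preservesBinaryBiproducts_of_preservesBinaryCoproducts _
  have : PreservesBinaryBiproducts (tilde.functor Γ(X, U.1)) :=
    preservesBinaryBiproducts_of_preservesBinaryCoproducts _
  let A := (modulesSpecToSheaf.obj (F.restrict ψ)).presheaf.obj (op ⊤)
  let B := (modulesSpecToSheaf.obj (G.restrict ψ)).presheaf.obj (op ⊤)
  let e : (tilde.functor _).obj (A ⊞ B) ≅ (restrictFunctor ψ).obj (F ⊞ G) :=
    (tilde.functor _).mapBiprod A B ≪≫
      biprod.mapIso (@asIso _ _ _ _ _ hM') (@asIso _ _ _ _ _ hN') ≪≫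
      ((restrictFunctor ψ).mapBiprod F G).symm
  let P : (tilde (A ⊞ B)).Presentation :=
    presentationTilde.{u} _ .univ (by simp) _ (Submodule.span_eq _)
  let P' : ((F ⊞ G).restrict ψ).Presentation := @SheafOfModules.Presentation.ofIsIso.{u, u, u} _ _ _ _ _ _ _ _ e.hom e.isIso_hom P
  let i : (restrictFunctor hU.isoSpec.hom).obj ((restrictFunctor ψ).obj (F ⊞ G)) ≅
      (restrictFunctor U.1.ι).obj (F ⊞ G) :=
    (restrictFunctorComp hU.isoSpec.hom ψ).symm.app _ ≪≫
      (restrictFunctorCongr hU.isoSpec_hom_fromSpec).app _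
  exact ⟨@SheafOfModules.Presentation.ofIsIso.{u, u, u} _ _ _ _ _ _ _ _ i.hom i.isIso_hom (presentationRestrict hU.isoSpec.hom P')⟩

/-- The ring homomorphism `R ⊕ M → S ⊕ N` of trivial square-zero extensions induced by a ring
homomorphism `f : R → S` and an `f`-semilinear map `g : M → N`. -/
def sqZeroMap {R S M N : Type*} [CommRing R] [CommRing S] [AddCommGroup M] [AddCommGroup N]
    [Module R M] [Module Rᵐᵒᵖ M] [IsCentralScalar R M]
    [Module S N] [Module Sᵐᵒᵖ N] [IsCentralScalar S N]
    (f : R →+* S) (g : M →+ N) (h : ∀ (r : R) (m : M), g (r • m) = f r • g m) :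
    TrivSqZeroExt R M →+* TrivSqZeroExt S N where
  toFun x := (f x.fst, g x.snd)
  map_one' := TrivSqZeroExt.ext (map_one f) (map_zero g)
  map_mul' x y := TrivSqZeroExt.ext (map_mul f _ _) (by
    change g (x.fst • y.snd + MulOpposite.op y.fst • x.snd) =
      f x.fst • g y.snd + MulOpposite.op (f y.fst) • g x.snd
    simp [h])
  map_zero' := TrivSqZeroExt.ext (map_zero f) (map_zero g)
  map_add' _ _ := TrivSqZeroExt.ext (map_add f _ _) (map_add g _ _)

section

variable {R S M N : Type*} [CommRing R] [CommRing S] [AddCommGroup M] [AddCommGroup N]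
  [Module R M] [Module Rᵐᵒᵖ M] [IsCentralScalar R M]
  [Module S N] [Module Sᵐᵒᵖ N] [IsCentralScalar S N]
  (f : R →+* S) (g : M →+ N) (h : ∀ (r : R) (m : M), g (r • m) = f r • g m)

@[simp] theorem sqZeroMap_fst (x : TrivSqZeroExt R M) : (sqZeroMap f g h x).fst = f x.fst := rfl

@[simp] theorem sqZeroMap_snd (x : TrivSqZeroExt R M) : (sqZeroMap f g h x).snd = g x.snd := rfl

/-- If `f : R → S` and `g : M → N` are localizations at `r`, so is `R ⊕ M → S ⊕ N`. -/
theorem isLocalization_sqZeroMap (r : R) (hr : IsUnit (f r))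
    (hf₁ : ∀ a : S, ∃ (n : ℕ) (b : R), f b = f (r ^ n) * a)
    (hf₂ : ∀ b : R, f b = 0 → ∃ n : ℕ, r ^ n * b = 0)
    (hg₁ : ∀ a : N, ∃ (n : ℕ) (b : M), g b = f (r ^ n) • a)
    (hg₂ : ∀ b : M, g b = 0 → ∃ n : ℕ, r ^ n • b = 0) :
    @IsLocalization _ _ (.powers (TrivSqZeroExt.inl r : TrivSqZeroExt R M)) (TrivSqZeroExt S N) _
      (RingHom.toAlgebra (sqZeroMap f g h)) := by
  have hp (n : ℕ) : (TrivSqZeroExt.inl r : TrivSqZeroExt R M) ^ n = TrivSqZeroExt.inl (r ^ n) :=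
    TrivSqZeroExt.inl_pow r n
  have hi (a : R) : sqZeroMap f g h (TrivSqZeroExt.inl a) = TrivSqZeroExt.inl (f a) := by
    ext <;> simp
  let := RingHom.toAlgebra (sqZeroMap f g h)
  refine (isLocalization_iff _ _).mpr ⟨?_, ?_, ?_⟩
  · rintro ⟨_, n, rfl⟩
    change IsUnit (sqZeroMap f g h (TrivSqZeroExt.inl r ^ n))
    rw [map_pow, hi]
    exact (hr.map (TrivSqZeroExt.inlHom S N)).pow n
  · intro z
    obtain ⟨n, b, hb⟩ := hf₁ z.fst
    obtain ⟨k, m, hm⟩ := hg₁ z.snd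
    refine ⟨⟨TrivSqZeroExt.inl (r ^ k * b) + TrivSqZeroExt.inr (r ^ n • m), ⟨_, n + k, rfl⟩⟩, ?_⟩
    change z * sqZeroMap f g h (TrivSqZeroExt.inl r ^ (n + k)) = sqZeroMap f g h _
    rw [hp, hi]
    ext
    · simp only [TrivSqZeroExt.fst_mul, TrivSqZeroExt.fst_inl, sqZeroMap_fst,
        TrivSqZeroExt.fst_add, TrivSqZeroExt.fst_inr, add_zero, map_mul, hb, pow_add]
      ring
    · simp only [TrivSqZeroExt.snd_mul, TrivSqZeroExt.fst_inl, TrivSqZeroExt.snd_inl, smul_zero,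
        sqZeroMap_snd, TrivSqZeroExt.snd_add, TrivSqZeroExt.snd_inr, zero_add, h, hm, op_smul_eq_smul,
        smul_smul, ← map_mul, pow_add]
  · intro x y hxy
    replace hxy : sqZeroMap f g h (x - y) = 0 := by
      rw [map_sub, sub_eq_zero]; exact hxy
    obtain ⟨n, hn⟩ := hf₂ (x - y).fst (congrArg TrivSqZeroExt.fst hxy)
    obtain ⟨k, hk⟩ := hg₂ (x - y).snd (congrArg TrivSqZeroExt.snd hxy)
    refine ⟨⟨_, n + k, rfl⟩, ?_⟩
    change TrivSqZeroExt.inl r ^ (n + k) * x = TrivSqZeroExt.inl r ^ (n + k) * y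
    rw [← sub_eq_zero, ← mul_sub, hp]
    ext
    · simp only [TrivSqZeroExt.fst_mul, TrivSqZeroExt.fst_inl, pow_add, TrivSqZeroExt.fst_zero]
      rw [mul_right_comm, hn, zero_mul]
    · simp only [TrivSqZeroExt.snd_mul, TrivSqZeroExt.fst_inl, TrivSqZeroExt.snd_inl, smul_zero,
        add_zero, pow_add, TrivSqZeroExt.snd_zero]
      rw [mul_smul, hk, smul_zero]

end



instance (F : X.Modules) (U : X.Opens) : Module (Γ(X, U))ᵐᵒᵖ Γ(F, U) :=
  Module.compHom Γ(F, U) ((RingHom.id Γ(X, U)).fromOpposite fun _ _ ↦ Commute.all _ _)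

instance (F : X.Modules) (U : X.Opens) : IsCentralScalar Γ(X, U) Γ(F, U) := ⟨fun _ _ ↦ rfl⟩

/-- The sheaf of `𝒪_X`-algebras `Sym^{≤ 1} F = 𝒪_X ⊕ F`, in which `F` squares to zero. -/
def symLeOne (F : X.Modules) : X.Opensᵒᵖ ⥤ CommRingCat.{u} where
  obj U := .of (TrivSqZeroExt Γ(X, U.unop) Γ(F, U.unop))
  map i := CommRingCat.ofHom (sqZeroMap (X.presheaf.map i).hom (F.presheaf.map i).hom
    fun r m ↦ F.map_smul i.unop r m)
  map_id U := by ext x <;> simp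
  map_comp i j := by ext x <;> simp

/-- The structure map `𝒪_X → 𝒪_X ⊕ F`. -/
def symLeOneUnit (F : X.Modules) : X.presheaf ⟶ F.symLeOne where
  app U := CommRingCat.ofHom (TrivSqZeroExt.inlHom Γ(X, U.unop) Γ(F, U.unop))
  naturality U V i := by
    ext x
    apply TrivSqZeroExt.ext
    · rfl
    · exact (map_zero (F.presheaf.map i).hom).symm

/-- The augmentation `𝒪_X ⊕ F → 𝒪_X`. -/
def symLeOneAug (F : X.Modules) : F.symLeOne ⟶ X.presheaf where
  app U := CommRingCat.ofHom
    (TrivSqZeroExt.fstHom Γ(X, U.unop) Γ(X, U.unop) Γ(F, U.unop)).toRingHom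
  naturality U V i := by
    ext x
    rfl

/-- The algebra homomorphism `𝒪_X ⊕ F → 𝒪_X ⊕ G` induced by a module homomorphism `F → G`. -/
def symLeOneMap {F G : X.Modules} (φ : F ⟶ G) : F.symLeOne ⟶ G.symLeOne where
  app U := CommRingCat.ofHom (sqZeroMap (RingHom.id Γ(X, U.unop)) (φ.app U.unop).hom
    fun r m ↦ φ.app_smul r m)
  naturality U V i := by
    ext x
    apply TrivSqZeroExt.ext
    · rfl
    · exact ConcreteCategory.congr_hom (φ.mapPresheaf.naturality i) (TrivSqZeroExt.snd x)

theorem symLeOneUnit_coequifibered (F : X.Modules) [F.IsQuasicoherent] :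
    (Functor.whiskerLeft (AffineZariskiSite.toOpensFunctor X).op F.symLeOneUnit).Coequifibered := by
  refine AffineZariskiSite.coequifibered_iff_forall_isLocalizationAway.mpr fun U r ↦ ?_
  have := U.2.isLocalization_basicOpen r
  let i := (homOfLE (X.basicOpen_le r)).op
  refine isLocalization_sqZeroMap (X.presheaf.map i).hom (F.presheaf.map i).hom
    (fun r m ↦ F.map_smul i.unop r m) r (X.toRingedSpace.isUnit_res_basicOpen r) ?_ ?_
    (exists_map_eq_pow_smul U.2 r) (exists_pow_smul_eq_zero U.2 r)
  · intro a
    obtain ⟨n, b, hb⟩ := IsLocalization.Away.surj r a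
    exact ⟨n, b, by rw [mul_comm, map_pow]; exact hb.symm⟩
  · intro b hb
    exact (IsLocalization.Away.exists_of_eq (S := Γ(X, X.basicOpen r)) r
      (hb.trans (map_zero _).symm)).imp fun n hn ↦ by simpa using hn

/-- The gluing datum of the relative spectrum of `𝒪_X ⊕ F`: the schemes
`Spec (Γ(X, U) ⊕ Γ(F, U))` over the affine opens `U` of `X`. -/
def nilGluingData (F : X.Modules) [F.IsQuasicoherent] :
    (AffineZariskiSite.directedCover X).RelativeGluingData :=
  AffineZariskiSite.relativeGluingData F.symLeOneUnit_coequifibered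

instance (F : X.Modules) [F.IsQuasicoherent] :
    (F.nilGluingData.functor ⋙ Scheme.forget).IsLocallyDirected :=
  Cover.RelativeGluingData.instIsLocallyDirectedI₀CompFunctorForgetOfIsThin ..

instance (F : X.Modules) [F.IsQuasicoherent] {U V : (AffineZariskiSite.directedCover X).I₀}
    (i : U ⟶ V) : IsOpenImmersion (F.nilGluingData.functor.map i) :=
  Cover.RelativeGluingData.instIsOpenImmersionMapI₀Functor ..

instance (F : X.Modules) [F.IsQuasicoherent] : HasColimit F.nilGluingData.functor :=
  inferInstanceAs (HasColimit F.nilGluingData.functor)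

/-- The nilpotent thickening `Nil_X(F)`, the relative spectrum of `𝒪_X ⊕ F` over `X`. -/
def nil (F : X.Modules) [F.IsQuasicoherent] : Scheme.{u} :=
  F.nilGluingData.glued

/-- The structure morphism `Nil_X(F) → X`. -/
def nilToBase (F : X.Modules) [F.IsQuasicoherent] : F.nil ⟶ X :=
  F.nilGluingData.toBase

/-- The open immersion `Spec (Γ(X, U) ⊕ Γ(F, U)) → Nil_X(F)`. -/
def nilι (F : X.Modules) [F.IsQuasicoherent] (U : X.AffineZariskiSite) :
    Spec (F.symLeOne.obj (op U.toOpens)) ⟶ F.nil :=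
  colimit.ι F.nilGluingData.functor U

theorem nilι_w (F : X.Modules) [F.IsQuasicoherent] {U V : X.AffineZariskiSite} (i : U ⟶ V) :
    Spec.map (F.symLeOne.map ((AffineZariskiSite.toOpensFunctor X).map i).op) ≫ F.nilι V =
      F.nilι U :=
  colimit.w F.nilGluingData.functor i

theorem nilι_toBase (F : X.Modules) [F.IsQuasicoherent] (U : X.AffineZariskiSite) :
    F.nilι U ≫ F.nilToBase = Spec.map (F.symLeOneUnit.app (op U.toOpens)) ≫ U.2.fromSpec := by
  have h := F.nilGluingData.ι_toBase U
  refine h.trans ?_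
  change (Spec.map (F.symLeOneUnit.app (op U.toOpens)) ≫ U.2.isoSpec.inv) ≫ U.toOpens.ι = _
  rw [Category.assoc, U.2.isoSpec_inv_ι]

theorem nil_hom_ext (F : X.Modules) [F.IsQuasicoherent] {T : Scheme.{u}} {a b : F.nil ⟶ T}
    (h : ∀ U, F.nilι U ≫ a = F.nilι U ≫ b) : a = b :=
  colimit.hom_ext h

theorem specMap_naturality {A B : X.Opensᵒᵖ ⥤ CommRingCat.{u}} (α : A ⟶ B) {U V : X.Opensᵒᵖ}
    (i : U ⟶ V) {T : Scheme.{u}} (t : Spec (A.obj U) ⟶ T) :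
    Spec.map (B.map i) ≫ Spec.map (α.app U) ≫ t =
      Spec.map (α.app V) ≫ Spec.map (A.map i) ≫ t := by
  rw [← Spec.map_comp_assoc, ← Spec.map_comp_assoc, α.naturality]

/-- The section `X → Nil_X(F)` given on `U` by the spectrum of `Γ(X, U) ⊕ Γ(F, U) → Γ(X, U)`. -/
def nilSection (F : X.Modules) [F.IsQuasicoherent] : X ⟶ F.nil :=
  (AffineZariskiSite.isColimitCocone X).desc
    { pt := F.nil
      ι :=
        { app U := Spec.map (F.symLeOneAug.app (op U.toOpens)) ≫ F.nilι U
          naturality U V i := by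
            exact (specMap_naturality F.symLeOneAug _ _).trans
              ((congrArg _ (F.nilι_w i)).trans (Category.comp_id _).symm) } }

theorem fromSpec_nilSection (F : X.Modules) [F.IsQuasicoherent] (U : X.AffineZariskiSite) :
    U.2.fromSpec ≫ F.nilSection = Spec.map (F.symLeOneAug.app (op U.toOpens)) ≫ F.nilι U :=
  (AffineZariskiSite.isColimitCocone X).fac _ U

/-- The morphism `Nil_X(G) → Nil_X(F)` induced by a homomorphism `F → G`. -/
def nilMap {F G : X.Modules} [F.IsQuasicoherent] [G.IsQuasicoherent] (φ : F ⟶ G) :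
    G.nil ⟶ F.nil :=
  colimit.desc G.nilGluingData.functor
    { pt := F.nil
      ι :=
        { app U := Spec.map ((symLeOneMap φ).app (op U.toOpens)) ≫ F.nilι U
          naturality U V i := by
            exact (specMap_naturality (symLeOneMap φ) _ _).trans
              ((congrArg _ (F.nilι_w i)).trans (Category.comp_id _).symm) } }

theorem nilι_nilMap {F G : X.Modules} [F.IsQuasicoherent] [G.IsQuasicoherent] (φ : F ⟶ G)
    (U : X.AffineZariskiSite) :
    G.nilι U ≫ nilMap φ = Spec.map ((symLeOneMap φ).app (op U.toOpens)) ≫ F.nilι U :=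
  colimit.ι_desc _ U


theorem nilSection_toBase (F : X.Modules) [F.IsQuasicoherent] :
    F.nilSection ≫ F.nilToBase = 𝟙 X := by
  refine (AffineZariskiSite.isColimitCocone X).hom_ext fun U ↦ ?_
  change U.2.fromSpec ≫ _ = U.2.fromSpec ≫ 𝟙 X
  rw [← Category.assoc, fromSpec_nilSection, Category.assoc, nilι_toBase, ← Spec.map_comp_assoc,
    Category.comp_id]
  exact (congrArg (· ≫ U.2.fromSpec) (Spec.map_id _)).trans (Category.id_comp _)

section

variable {F G : X.Modules} [F.IsQuasicoherent] [G.IsQuasicoherent] (φ : F ⟶ G)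

theorem nilMap_toBase : nilMap φ ≫ F.nilToBase = G.nilToBase := by
  refine G.nil_hom_ext fun U ↦ ?_
  rw [← Category.assoc, nilι_nilMap, Category.assoc, nilι_toBase, nilι_toBase,
    ← Spec.map_comp_assoc]
  congr 2
  ext x
  exact TrivSqZeroExt.ext rfl (map_zero (φ.app U.toOpens).hom)

theorem nilSection_nilMap : G.nilSection ≫ nilMap φ = F.nilSection := by
  refine (AffineZariskiSite.isColimitCocone X).hom_ext fun U ↦ ?_
  change U.2.fromSpec ≫ _ = U.2.fromSpec ≫ _
  rw [← Category.assoc, fromSpec_nilSection, fromSpec_nilSection, Category.assoc, nilι_nilMap,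
    ← Spec.map_comp_assoc]
  rfl

end

end AlgebraicGeometry.Scheme.Modules

namespace AlgebraicGeometry.Scheme

/-- The category `X/Sch_X` of `X`-schemes with a section: the coslice category under `X` of the
category of schemes over `X`. -/
abbrev PointedOver (X : Scheme.{u}) : Type (u + 1) := Under (Over.mk (𝟙 X))

namespace PointedOver

variable {X : Scheme.{u}}

/-- The underlying scheme `Y` of an object `X → Y → X` of `X/Sch_X`. -/
abbrev scheme (Y : X.PointedOver) : Scheme.{u} := Y.right.left

/-- The structure morphism `Y → X`. -/
abbrev toBase (Y : X.PointedOver) : Y.scheme ⟶ X := Y.right.hom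

/-- The section `X → Y`. -/
abbrev sec (Y : X.PointedOver) : X ⟶ Y.scheme := Y.hom.left

theorem sec_toBase (Y : X.PointedOver) : Y.sec ≫ Y.toBase = 𝟙 X := Over.w Y.hom

/-- The morphism of schemes underlying a morphism in `X/Sch_X`. -/
abbrev schemeHom {Y T : X.PointedOver} (f : Y ⟶ T) : Y.scheme ⟶ T.scheme := f.right.left

/-- The object of `X/Sch_X` given by a scheme `Y`, a morphism `p : Y → X` and a section of `p`. -/
def mk (Y : Scheme.{u}) (p : Y ⟶ X) (s : X ⟶ Y) (h : s ≫ p = 𝟙 X) : X.PointedOver :=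
  Under.mk (Y := Over.mk p) (Over.homMk s h)

/-- The morphism in `X/Sch_X` given by a morphism of schemes compatible with the structure
morphisms and the sections. -/
def homMk {Y T : X.PointedOver} (f : Y.scheme ⟶ T.scheme) (hp : f ≫ T.toBase = Y.toBase)
    (hs : Y.sec ≫ f = T.sec) : Y ⟶ T :=
  Under.homMk (Over.homMk f hp) (by ext1; exact hs)

/-- The trivial morphism `Y → X → T` in `X/Sch_X`. -/
def trivialHom (Y T : X.PointedOver) : Y ⟶ T :=
  homMk (Y.toBase ≫ T.sec) (by rw [Category.assoc, T.sec_toBase, Category.comp_id])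
    (by rw [← Category.assoc, Y.sec_toBase, Category.id_comp])

end PointedOver

/-- An object of `X/Sch_X` (called `obj`), a second object with two morphisms from `obj`
(a candidate for `obj ⨿_X obj`), and candidates for a comultiplication and an inversion. -/
structure CogroupData (X : Scheme.{u}) where
  obj : X.PointedOver
  coprod : X.PointedOver
  inl : obj ⟶ coprod
  inr : obj ⟶ coprod
  comul : obj ⟶ coprod
  inv : obj ⟶ obj

namespace CogroupData

variable {X : Scheme.{u}}

/-- The composition law `f * g = [f, g] ∘ c` on the set of morphisms `Y → T` in `X/Sch_X`, where
`c : Y → Y ⨿_X Y` is the comultiplication. -/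
def conv (D : CogroupData X) (h : IsColimit (BinaryCofan.mk D.inl D.inr)) {T : X.PointedOver}
    (f g : D.obj ⟶ T) : D.obj ⟶ T :=
  D.comul ≫ h.desc (BinaryCofan.mk f g)

/-- `(Y, c, ι)` is a cogroup object of `X/Sch_X`: the coproduct `Y ⨿_X Y` in `X/Sch_X` exists (and
is the given one), and `c` and `ι` make every set of morphisms `Y → T` into a group, whose neutral
element is the trivial morphism. -/
def IsCogroup (D : CogroupData X) : Prop :=
  ∃ h : IsColimit (BinaryCofan.mk D.inl D.inr), ∀ T : X.PointedOver,
    (∀ f g k : D.obj ⟶ T, D.conv h (D.conv h f g) k = D.conv h f (D.conv h g k)) ∧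
    (∀ f : D.obj ⟶ T, D.conv h (D.obj.trivialHom T) f = f ∧
      D.conv h f (D.obj.trivialHom T) = f) ∧
    (∀ f : D.obj ⟶ T, D.conv h (D.inv ≫ f) f = D.obj.trivialHom T ∧
      D.conv h f (D.inv ≫ f) = D.obj.trivialHom T)

/-- An isomorphism `(Y, c, ι) ≅ (Y', c', ι')`: an isomorphism `Y ≅ Y'` in `X/Sch_X` and an
isomorphism `Y ⨿_X Y ≅ Y' ⨿_X Y'` compatible with the coproduct inclusions, such that
comultiplications and inversions correspond. If `(Y, c, ι)` is a cogroup object, the existence of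
such an isomorphism implies that `(Y', c', ι')` is one as well. -/
structure CogroupIso (D E : CogroupData X) where
  obj : D.obj ≅ E.obj
  coprod : D.coprod ≅ E.coprod
  inl_comp : D.inl ≫ coprod.hom = obj.hom ≫ E.inl
  inr_comp : D.inr ≫ coprod.hom = obj.hom ≫ E.inr
  comul_comp : D.comul ≫ coprod.hom = obj.hom ≫ E.comul
  inv_comp : D.inv ≫ obj.hom = obj.hom ≫ E.inv

end CogroupData

namespace Modules

variable {X : Scheme.{u}}

/-- `Nil_X(F)` as an object of `X/Sch_X`. -/
def nilPointed (F : X.Modules) [F.IsQuasicoherent] : X.PointedOver :=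
  .mk F.nil F.nilToBase F.nilSection F.nilSection_toBase

/-- The morphism `Nil_X(G) → Nil_X(F)` in `X/Sch_X` induced by a homomorphism `F → G`. -/
def nilPointedMap {F G : X.Modules} [F.IsQuasicoherent] [G.IsQuasicoherent] (φ : F ⟶ G) :
    G.nilPointed ⟶ F.nilPointed :=
  PointedOver.homMk (nilMap φ) (nilMap_toBase φ) (nilSection_nilMap φ)

/-- The standard cogroup structure on `Nil_X(F)`: the coproduct is `Nil_X(F ⊕ F)`, whose
inclusions are induced by the two projections `F ⊕ F → F`, the comultiplication is induced by
addition `F ⊕ F → F`, and the inversion by `-1 : F → F`. -/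
def nilCogroup (F : X.Modules) [F.IsQuasicoherent] : CogroupData X where
  obj := F.nilPointed
  coprod := (F ⊞ F).nilPointed
  inl := nilPointedMap biprod.fst
  inr := nilPointedMap biprod.snd
  comul := nilPointedMap (biprod.fst + biprod.snd)
  inv := nilPointedMap (-𝟙 F)

end Modules

end AlgebraicGeometry.Scheme

end

/-! The counit law says that `[trivial, id]` and `[id, trivial]` are both left inverse to the
comultiplication `c`. A point `c y` lies in one of the two copies of `Y`, and one of these two
morphisms sends that copy into the section, so `y` lies on the section
(`CogroupData.surjective_sec`). Hence `σ` and `p` are mutually inverse homeomorphisms. The same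
holds for `Y ⨿_X Y`, and both schemes are affine over `X`, so everything can be read off from
sections over affine opens of `X`.

A function on `Y ⨿_X Y` that vanishes on both copies of `Y` is zero (`eq_zero_of_isColimit`). For
`a`, `b` in the augmentation ideal `I`, the function `[id, trivial]^* a * [trivial, id]^* b`
vanishes on both copies; pulling it back along `c` gives `a * b = 0` (`mul_eq_zero_of_aug_eq_zero`).
Thus `p_* 𝒪_Y = 𝒪_X ⊕ I` with `I` quasi-coherent and of square zero, and `Y ≅ Nil_X(I)`
(`nonempty_iso_nilPointed`).

The cogroup structure is then forced. Functions on `Nil_X(F ⊕ F)` over affine opens are pairs of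
functions on `Nil_X(F)` with the same restriction to `X`, so `Y ⨿_X Y` is identified with it
(`isIso_desc_nilPointedMap`). They are also sums of functions pulled back along the two projections
to `Nil_X(F)`, so a morphism into `Nil_X(F ⊕ F)` from an object affine over `X` is determined by two
components, and the counit law prescribes those of `c`. The inversion agrees because inverses in a
group are unique (`nonempty_cogroupIso`). Uniqueness of the module is full faithfulness of `F ↦
Nil_X(F)` (`exists_nilPointedMap_eq`, `nilPointedMap_injective`). -/

noncomputable section

/-! ### Augmented algebras of sections, and morphisms between objects affine over the base. -/

namespace AlgebraicGeometry.Scheme.PointedOver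

variable {X : Scheme.{u}}

/-- The algebra of sections of `p_* 𝒪_Y` over `U`. -/
abbrev sections (Y : X.PointedOver) (U : X.Opens) : CommRingCat.{u} :=
  Γ(Y.scheme, Y.toBase ⁻¹ᵁ U)

theorem schemeHom_toBase {Y T : X.PointedOver} (f : Y ⟶ T) : schemeHom f ≫ T.toBase = Y.toBase :=
  Over.w f.right

theorem sec_schemeHom {Y T : X.PointedOver} (f : Y ⟶ T) : Y.sec ≫ schemeHom f = T.sec :=
  congrArg CommaMorphism.left (Under.w f)

theorem hom_ext_schemeHom {Y T : X.PointedOver} {f g : Y ⟶ T} (h : schemeHom f = schemeHom g) : f = g := by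
  ext
  exact h

theorem le_preimage {Y T : X.PointedOver} (f : Y ⟶ T) (U : X.Opens) :
    Y.toBase ⁻¹ᵁ U ≤ schemeHom f ⁻¹ᵁ (T.toBase ⁻¹ᵁ U) := by
  rw [← Hom.comp_preimage, schemeHom_toBase]

theorem le_sec_preimage (Y : X.PointedOver) (U : X.Opens) :
    U ≤ Y.sec ⁻¹ᵁ (Y.toBase ⁻¹ᵁ U) := by
  rw [← Hom.comp_preimage, sec_toBase]
  rfl

/-- The homomorphism of algebras of sections induced by a morphism in `X/Sch_X`. -/
def pull {Y T : X.PointedOver} (f : Y ⟶ T) (U : X.Opens) : T.sections U ⟶ Y.sections U :=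
  (schemeHom f).appLE _ _ (le_preimage f U)

/-- The structure map `𝒪_X → p_* 𝒪_Y` on sections. -/
def unit (Y : X.PointedOver) (U : X.Opens) : Γ(X, U) ⟶ Y.sections U := Y.toBase.app U

/-- The augmentation `p_* 𝒪_Y → 𝒪_X` on sections. -/
def aug (Y : X.PointedOver) (U : X.Opens) : Y.sections U ⟶ Γ(X, U) :=
  Y.sec.appLE _ _ (Y.le_sec_preimage U)

/-- The restriction maps of `p_* 𝒪_Y`. -/
def res (Y : X.PointedOver) {U V : X.Opens} (i : U ⟶ V) : Y.sections V ⟶ Y.sections U :=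
  Y.scheme.presheaf.map ((Opens.map Y.toBase.base).map i).op

theorem pull_id (Y : X.PointedOver) (U : X.Opens) : pull (𝟙 Y) U = 𝟙 _ := by
  change Hom.appLE (𝟙 Y.scheme) _ _ _ = _
  exact (Category.id_comp _).trans (Y.scheme.presheaf.map_id _)

theorem pull_comp {Y T W : X.PointedOver} (f : Y ⟶ T) (g : T ⟶ W) (U : X.Opens) :
    pull (f ≫ g) U = pull g U ≫ pull f U :=
  (Hom.appLE_comp_appLE ..).symm

theorem unit_pull {Y T : X.PointedOver} (f : Y ⟶ T) (U : X.Opens) :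
    T.unit U ≫ pull f U = Y.unit U := by
  rw [unit, unit, pull, Hom.app_eq_appLE, Hom.app_eq_appLE, Hom.appLE_comp_appLE]
  simp only [schemeHom_toBase]

theorem pull_aug {Y T : X.PointedOver} (f : Y ⟶ T) (U : X.Opens) :
    pull f U ≫ Y.aug U = T.aug U := by
  rw [aug, aug, pull, Hom.appLE_comp_appLE]
  simp only [sec_schemeHom]

theorem unit_aug (Y : X.PointedOver) (U : X.Opens) : Y.unit U ≫ Y.aug U = 𝟙 _ := by
  rw [unit, aug, Hom.app_eq_appLE, Hom.appLE_comp_appLE]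
  simp only [sec_toBase]
  exact (Category.id_comp _).trans (X.presheaf.map_id _)

theorem pull_trivialHom (Y T : X.PointedOver) (U : X.Opens) :
    pull (trivialHom Y T) U = T.aug U ≫ Y.unit U := by
  rw [unit, aug, Hom.app_eq_appLE, Hom.appLE_comp_appLE]
  rfl

theorem res_pull {Y T : X.PointedOver} (f : Y ⟶ T) {U V : X.Opens} (i : U ⟶ V) :
    T.res i ≫ pull f U = pull f V ≫ Y.res i := by
  rw [res, res, pull, pull, Hom.map_appLE, Hom.appLE_map]

theorem unit_res (Y : X.PointedOver) {U V : X.Opens} (i : U ⟶ V) :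
    Y.unit V ≫ Y.res i = X.presheaf.map i.op ≫ Y.unit U :=
  (Y.toBase.naturality i.op).symm

theorem res_aug (Y : X.PointedOver) {U V : X.Opens} (i : U ⟶ V) :
    Y.res i ≫ Y.aug U = Y.aug V ≫ X.presheaf.map i.op := by
  rw [res, aug, aug, Hom.map_appLE, Hom.appLE_map]

theorem comp_trivialHom {Y T : X.PointedOver} (f : Y ⟶ T) (W : X.PointedOver) :
    f ≫ trivialHom T W = trivialHom Y W := by
  refine hom_ext_schemeHom ?_
  change schemeHom f ≫ T.toBase ≫ W.sec = Y.toBase ≫ W.sec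
  rw [← Category.assoc, schemeHom_toBase]

@[simp] theorem pull_unit_apply {Y T : X.PointedOver} (f : Y ⟶ T) (U : X.Opens) (r : Γ(X, U)) :
    pull f U (T.unit U r) = Y.unit U r :=
  ConcreteCategory.congr_hom (unit_pull f U) r

@[simp] theorem aug_pull_apply {Y T : X.PointedOver} (f : Y ⟶ T) (U : X.Opens)
    (a : T.sections U) : Y.aug U (pull f U a) = T.aug U a :=
  ConcreteCategory.congr_hom (pull_aug f U) a

@[simp] theorem aug_unit_apply (Y : X.PointedOver) (U : X.Opens) (r : Γ(X, U)) :
    Y.aug U (Y.unit U r) = r :=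
  ConcreteCategory.congr_hom (unit_aug Y U) r

@[simp] theorem pull_trivialHom_apply (Y T : X.PointedOver) (U : X.Opens) (a : T.sections U) :
    pull (trivialHom Y T) U a = Y.unit U (T.aug U a) :=
  ConcreteCategory.congr_hom (pull_trivialHom Y T U) a

theorem pull_comp_apply {Y T W : X.PointedOver} (f : Y ⟶ T) (g : T ⟶ W) (U : X.Opens)
    (a : W.sections U) : pull (f ≫ g) U a = pull f U (pull g U a) :=
  ConcreteCategory.congr_hom (pull_comp f g U) a

theorem pull_id_apply (Y : X.PointedOver) (U : X.Opens) (a : Y.sections U) :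
    pull (𝟙 Y) U a = a :=
  ConcreteCategory.congr_hom (pull_id Y U) a

/-- The preimage in `Y` of an affine open of `X` is affine if `Y → X` is an affine morphism. -/
theorem isAffineOpen (Y : X.PointedOver) [IsAffineHom Y.toBase] (U : X.AffineZariskiSite) :
    IsAffineOpen (Y.toBase ⁻¹ᵁ U.toOpens) :=
  U.2.preimage Y.toBase

theorem fromSpec_schemeHom {Y T : X.PointedOver} [IsAffineHom Y.toBase] [IsAffineHom T.toBase]
    (f : Y ⟶ T) (U : X.AffineZariskiSite) :
    (Y.isAffineOpen U).fromSpec ≫ schemeHom f =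
      Spec.map (pull f U.toOpens) ≫ (T.isAffineOpen U).fromSpec :=
  (IsAffineOpen.SpecMap_appLE_fromSpec ..).symm

theorem iSup_preimage_eq_top (Y : X.PointedOver) :
    ⨆ U : X.AffineZariskiSite, Y.toBase ⁻¹ᵁ U.toOpens = ⊤ := by
  rw [← Hom.preimage_iSup]
  have : ⨆ U : X.AffineZariskiSite, U.toOpens = ⊤ := iSup_affineOpens_eq_top X
  rw [this, Hom.preimage_top]

/-- Morphisms between objects that are affine over `X` are determined by their effect on the
sections over affine opens. -/
theorem hom_ext_pull {Y T : X.PointedOver} [IsAffineHom Y.toBase] [IsAffineHom T.toBase]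
    {f g : Y ⟶ T} (h : ∀ U : X.AffineZariskiSite, pull f U.toOpens = pull g U.toOpens) :
    f = g := by
  refine hom_ext_schemeHom (Cover.hom_ext (Y.scheme.openCoverOfIsOpenCover _ Y.iSup_preimage_eq_top) _ _
    fun (U : X.AffineZariskiSite) ↦ ?_)
  change (Y.toBase ⁻¹ᵁ U.toOpens).ι ≫ _ = (Y.toBase ⁻¹ᵁ U.toOpens).ι ≫ _
  rw [← (Y.isAffineOpen U).isoSpec_hom_fromSpec, Category.assoc, Category.assoc,
    fromSpec_schemeHom, fromSpec_schemeHom, h]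

/-- A morphism between objects that are affine over `X` is an isomorphism if it induces
bijections on the sections over affine opens. -/
theorem isIso_of_pull_bijective {Y T : X.PointedOver} [IsAffineHom Y.toBase]
    [IsAffineHom T.toBase] (f : Y ⟶ T)
    (h : ∀ U : X.AffineZariskiSite, Function.Bijective (pull f U.toOpens)) : IsIso f := by
  have : IsAffineHom (schemeHom f ≫ T.toBase) := by rwa [schemeHom_toBase]
  have : IsAffineHom (schemeHom f) := .of_comp _ T.toBase
  have : IsIso ((Under.forget (Over.mk (𝟙 X)) ⋙ Over.forget X).map f) := by
    change IsIso (schemeHom f)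
    refine IsZariskiLocalAtTarget.of_iSup_eq_top (P := .isomorphisms Scheme) _
      T.iSup_preimage_eq_top fun U ↦ ?_
    refine (isIso_morphismRestrict_iff_isIso_app _ (T.isAffineOpen U)).mpr ?_
    have e : schemeHom f ⁻¹ᵁ (T.toBase ⁻¹ᵁ U.toOpens) = Y.toBase ⁻¹ᵁ U.toOpens := by
      rw [← Hom.comp_preimage, schemeHom_toBase]
    have : pull f U.toOpens = (schemeHom f).app _ ≫ Y.scheme.presheaf.map (eqToHom e.symm).op := by
      rw [Hom.app_eq_appLE, Hom.appLE_map, pull]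
    have h' : IsIso (pull f U.toOpens) := (ConcreteCategory.isIso_iff_bijective _).mpr (h U)
    rw [this] at h'
    exact IsIso.of_isIso_comp_right _ (Y.scheme.presheaf.map (eqToHom e.symm).op)
  exact isIso_of_reflects_iso f (Under.forget (Over.mk (𝟙 X)) ⋙ Over.forget X)

end AlgebraicGeometry.Scheme.PointedOver

end

/-! ### Affine charts of `Nil_X(F)` and faithfulness of `F ↦ Nil_X(F)`. -/

noncomputable section

namespace AlgebraicGeometry.Scheme

variable {X : Scheme.{u}}

theorem fromSpec_appLE_ΓSpecIso {Y : Scheme.{u}} {U : Y.Opens} (hU : IsAffineOpen U) (h) :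
    hU.fromSpec.appLE U ⊤ h ≫ (ΓSpecIso Γ(Y, U)).hom = 𝟙 _ := by
  have e : hU.fromSpec.appLE U ⊤ h = (ΓSpecIso Γ(Y, U)).inv := by
    rw [Hom.appLE, hU.fromSpec_app_self]
    refine (Category.assoc ..).trans (Eq.trans (congrArg _ ?_) (Category.comp_id _))
    exact ((Spec Γ(Y, U)).presheaf.map_comp _ _).symm.trans ((Spec Γ(Y, U)).presheaf.map_id _)
  rw [e, Iso.inv_hom_id]

theorem specMap_appLE_ΓSpecIso {A B : CommRingCat.{u}} (θ : A ⟶ B) (h) :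
    (Spec.map θ).appLE ⊤ ⊤ h ≫ (ΓSpecIso B).hom = (ΓSpecIso A).hom ≫ θ := by
  rw [← ΓSpecIso_naturality, Hom.appTop, Hom.app_eq_appLE]
  rfl

namespace PointedOver

/-- The ring homomorphism `Γ(Y, p⁻¹ U) → A` corresponding to an `A`-valued point of `Y` lying
over `U`. -/
def toRing {Y : X.PointedOver} {A : CommRingCat.{u}} (t : Spec A ⟶ Y.scheme) (U : X.Opens)
    (h : ⊤ ≤ t ⁻¹ᵁ (Y.toBase ⁻¹ᵁ U)) : Y.sections U ⟶ A :=
  t.appLE _ ⊤ h ≫ (ΓSpecIso A).hom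

variable {Y T : X.PointedOver} {A B : CommRingCat.{u}}

theorem le_preimage_comp (f : Y ⟶ T) {t : Spec A ⟶ Y.scheme} {U : X.Opens}
    (h : ⊤ ≤ t ⁻¹ᵁ (Y.toBase ⁻¹ᵁ U)) : ⊤ ≤ (t ≫ schemeHom f) ⁻¹ᵁ (T.toBase ⁻¹ᵁ U) :=
  h.trans (t.preimage_mono (le_preimage f U))

theorem pull_toRing (f : Y ⟶ T) {t : Spec A ⟶ Y.scheme} {U : X.Opens}
    (h : ⊤ ≤ t ⁻¹ᵁ (Y.toBase ⁻¹ᵁ U)) :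
    pull f U ≫ toRing t U h = toRing (t ≫ schemeHom f) U (le_preimage_comp f h) := by
  rw [pull, toRing, toRing, Hom.appLE_comp_appLE_assoc]

theorem toRing_congr {t t' : Spec A ⟶ Y.scheme} (e : t = t') {U : X.Opens}
    (h : ⊤ ≤ t ⁻¹ᵁ (Y.toBase ⁻¹ᵁ U)) : toRing t U h = toRing t' U (e ▸ h) := by
  subst e; rfl

theorem toRing_specMap_comp (θ : A ⟶ B) {t : Spec A ⟶ Y.scheme} {U : X.Opens}
    (h : ⊤ ≤ t ⁻¹ᵁ (Y.toBase ⁻¹ᵁ U)) (h') :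
    toRing (Spec.map θ ≫ t) U h' = toRing t U h ≫ θ := by
  have e : ⊤ ≤ Spec.map θ ⁻¹ᵁ ⊤ := le_rfl
  rw [toRing, toRing, Category.assoc, ← specMap_appLE_ΓSpecIso θ e, Hom.appLE_comp_appLE_assoc]

theorem res_toRing {t : Spec A ⟶ Y.scheme} {U V : X.Opens} (i : U ⟶ V)
    (h : ⊤ ≤ t ⁻¹ᵁ (Y.toBase ⁻¹ᵁ U)) :
    Y.res i ≫ toRing t U h =
      toRing t V (h.trans (t.preimage_mono (Y.toBase.preimage_mono i.le))) := by
  rw [res, toRing, toRing, Hom.map_appLE_assoc]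

end PointedOver

namespace Modules

open PointedOver

variable (F G H : X.Modules) [F.IsQuasicoherent] [G.IsQuasicoherent] [H.IsQuasicoherent]

instance (U : X.AffineZariskiSite) : IsOpenImmersion (F.nilι U) :=
  F.nilGluingData.cover.map_prop U

theorem opensRange_nilι (U : X.AffineZariskiSite) :
    (F.nilι U).opensRange = F.nilToBase ⁻¹ᵁ U.toOpens := by
  refine (F.nilGluingData.toBase_preimage_eq_opensRange_ι U).symm.trans ?_
  exact congrArg (F.nilToBase ⁻¹ᵁ ·) U.toOpens.opensRange_ι

instance : IsAffineHom F.nilToBase := by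
  refine ⟨fun U hU ↦ ?_⟩
  let V : X.AffineZariskiSite := ⟨U, hU⟩
  change IsAffineOpen (F.nilToBase ⁻¹ᵁ V.toOpens)
  rw [← F.opensRange_nilι V]
  exact isAffineOpen_opensRange _

instance : IsAffineHom F.nilPointed.toBase :=
  inferInstanceAs (IsAffineHom F.nilToBase)

/-- The chart of the scheme underlying `nilPointed F` over an affine open of `X`. -/
def nilChart (U : X.AffineZariskiSite) :
    Spec (F.symLeOne.obj (op U.toOpens)) ⟶ F.nilPointed.scheme :=
  F.nilι U

instance (U : X.AffineZariskiSite) : IsOpenImmersion (F.nilChart U) :=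
  inferInstanceAs (IsOpenImmersion (F.nilι U))

theorem opensRange_nilChart (U : X.AffineZariskiSite) :
    (F.nilChart U).opensRange = F.nilPointed.toBase ⁻¹ᵁ U.toOpens :=
  F.opensRange_nilι U

theorem top_le_nilChart_preimage (U : X.AffineZariskiSite) :
    ⊤ ≤ F.nilChart U ⁻¹ᵁ (F.nilPointed.toBase ⁻¹ᵁ U.toOpens) := by
  rw [← opensRange_nilChart, Hom.preimage_opensRange]

/-- The isomorphism from the sections of `Nil_X(F)` over an affine open `U` of `X` to
`Γ(X, U) ⊕ Γ(F, U)`. -/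
def nilRing (U : X.AffineZariskiSite) :
    F.nilPointed.sections U.toOpens ⟶ F.symLeOne.obj (op U.toOpens) :=
  toRing (F.nilChart U) U.toOpens (F.top_le_nilChart_preimage U)

/-- The chart is an open immersion whose range is exactly the preimage of `U`, so no functions over
`U` are lost or added. -/
instance (U : X.AffineZariskiSite) : IsIso (F.nilRing U) := by
  have h₁ : IsIso ((F.nilChart U).app (F.nilPointed.toBase ⁻¹ᵁ U.toOpens)) :=
    (F.nilChart U).isIso_app _ (F.opensRange_nilChart U).ge
  have h₂ : IsIso ((F.nilChart U).appLE (F.nilPointed.toBase ⁻¹ᵁ U.toOpens) ⊤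
      (F.top_le_nilChart_preimage U)) := by
    have : IsIso (homOfLE (F.top_le_nilChart_preimage U)) :=
      ⟨homOfLE le_top, Subsingleton.elim _ _, Subsingleton.elim _ _⟩
    exact IsIso.comp_isIso' h₁ inferInstance
  exact IsIso.comp_isIso' h₂ inferInstance

variable {F G H}

theorem nilChart_nilPointedMap (φ : F ⟶ G) (U : X.AffineZariskiSite) :
    G.nilChart U ≫ schemeHom (nilPointedMap φ) =
      Spec.map ((symLeOneMap φ).app (op U.toOpens)) ≫ F.nilChart U :=
  nilι_nilMap φ U

/-- With `res_nilRing`, `unit_nilRing` and `nilRing_aug`, this translates statements about `Nil_X`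
into statements about `𝒪_X ⊕ F` over affine opens. -/
theorem pull_nilRing (φ : F ⟶ G) (U : X.AffineZariskiSite) :
    pull (nilPointedMap φ) U.toOpens ≫ G.nilRing U =
      F.nilRing U ≫ (symLeOneMap φ).app (op U.toOpens) := by
  rw [nilRing, pull_toRing, toRing_congr (nilChart_nilPointedMap φ U)]
  exact toRing_specMap_comp ..

variable (F)

theorem nilChart_w {U V : X.AffineZariskiSite} (i : U ⟶ V) :
    Spec.map (F.symLeOne.map ((AffineZariskiSite.toOpensFunctor X).map i).op) ≫ F.nilChart V =
      F.nilChart U :=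
  F.nilι_w i

theorem nilChart_toBase (U : X.AffineZariskiSite) :
    F.nilChart U ≫ F.nilPointed.toBase =
      Spec.map (F.symLeOneUnit.app (op U.toOpens)) ≫ U.2.fromSpec :=
  F.nilι_toBase U

theorem fromSpec_sec (U : X.AffineZariskiSite) :
    U.2.fromSpec ≫ F.nilPointed.sec =
      Spec.map (F.symLeOneAug.app (op U.toOpens)) ≫ F.nilChart U :=
  F.fromSpec_nilSection U

theorem res_nilRing {U V : X.AffineZariskiSite} (i : U ⟶ V) :
    F.nilPointed.res ((AffineZariskiSite.toOpensFunctor X).map i) ≫ F.nilRing U =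
      F.nilRing V ≫ F.symLeOne.map ((AffineZariskiSite.toOpensFunctor X).map i).op := by
  refine (res_toRing _ _).trans ((toRing_congr (F.nilChart_w i).symm _).trans ?_)
  exact toRing_specMap_comp ..

theorem unit_nilRing (U : X.AffineZariskiSite) :
    F.nilPointed.unit U.toOpens ≫ F.nilRing U = F.symLeOneUnit.app (op U.toOpens) := by
  have h : ⊤ ≤ U.2.fromSpec ⁻¹ᵁ U.toOpens := by simp
  have e : ⊤ ≤ Spec.map (F.symLeOneUnit.app (op U.toOpens)) ⁻¹ᵁ ⊤ := le_rfl
  rw [PointedOver.unit, nilRing, toRing, Hom.app_eq_appLE, Hom.appLE_comp_appLE_assoc]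
  simp only [nilChart_toBase]
  rw [← Hom.appLE_comp_appLE _ _ _ ⊤ _ h e, Category.assoc]
  refine (congrArg _ (specMap_appLE_ΓSpecIso _ _)).trans ?_
  refine (Category.assoc ..).symm.trans ((congrArg (· ≫ _) (fromSpec_appLE_ΓSpecIso U.2 h)).trans ?_)
  exact Category.id_comp _

theorem nilRing_aug (U : X.AffineZariskiSite) :
    F.nilRing U ≫ F.symLeOneAug.app (op U.toOpens) = F.nilPointed.aug U.toOpens := by
  have h : ⊤ ≤ U.2.fromSpec ⁻¹ᵁ U.toOpens := by simp
  have e := (congrArg (F.nilPointed.aug U.toOpens ≫ ·)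
    (fromSpec_appLE_ΓSpecIso U.2 h)).trans (Category.comp_id _)
  refine Eq.trans ?_ e
  rw [aug, Hom.appLE_comp_appLE_assoc]
  simp only [fromSpec_sec]
  exact (toRing_specMap_comp _ (F.top_le_nilChart_preimage U) _).symm

theorem nilMap_id : nilMap (𝟙 F) = 𝟙 F.nil := by
  refine F.nil_hom_ext fun U ↦ ?_
  rw [nilι_nilMap, Category.comp_id]
  exact (congrArg (· ≫ F.nilι U) (Spec.map_id _)).trans (Category.id_comp _)

theorem nilPointedMap_id : nilPointedMap (𝟙 F) = 𝟙 F.nilPointed :=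
  hom_ext_schemeHom (nilMap_id F)

variable {F}

theorem nilPointedMap_comp (φ : F ⟶ G) (ψ : G ⟶ H) :
    nilPointedMap (φ ≫ ψ) = nilPointedMap ψ ≫ nilPointedMap φ := by
  refine hom_ext_schemeHom (H.nil_hom_ext fun U ↦ ?_)
  change H.nilι U ≫ nilMap (φ ≫ ψ) = H.nilι U ≫ nilMap ψ ≫ nilMap φ
  rw [nilι_nilMap, ← Category.assoc, nilι_nilMap, Category.assoc, nilι_nilMap,
    ← Spec.map_comp_assoc]
  rfl

/-- Both sides act on sections as the augmentation followed by the unit. This links the zero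
components of the biproduct to the neutral element of the group law. -/
theorem nilPointedMap_zero : nilPointedMap (0 : F ⟶ G) = trivialHom G.nilPointed F.nilPointed := by
  refine hom_ext_pull fun U ↦ ?_
  rw [← cancel_mono (G.nilRing U), pull_nilRing, pull_trivialHom, Category.assoc, unit_nilRing,
    ← nilRing_aug, Category.assoc]
  congr 1

/-- Over an affine open the module map is the second component of the algebra map on elements `inr
m`. Affine opens form a dense subsite, so agreement there gives agreement as maps into the sheaf
`G`. -/
theorem nilPointedMap_injective {φ ψ : F ⟶ G} (h : nilPointedMap φ = nilPointedMap ψ) :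
    φ = ψ := by
  have key (U : X.AffineZariskiSite) : φ.app U.toOpens = ψ.app U.toOpens := by
    have : (symLeOneMap φ).app (op U.toOpens) = (symLeOneMap ψ).app (op U.toOpens) := by
      rw [← cancel_epi (F.nilRing U), ← pull_nilRing, ← pull_nilRing, h]
    ext m
    exact congrArg TrivSqZeroExt.snd (ConcreteCategory.congr_hom this (TrivSqZeroExt.inr m))
  have : (Functor.IsCoverDense.restrictHomEquivHom (K := Opens.grothendieckTopology X)
      (G := AffineZariskiSite.toOpensFunctor X) (ℱ' := ⟨G.presheaf, G.isSheaf⟩)).symm φ.mapPresheaf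
      = (Functor.IsCoverDense.restrictHomEquivHom (K := Opens.grothendieckTopology X)
      (G := AffineZariskiSite.toOpensFunctor X) (ℱ' := ⟨G.presheaf, G.isSheaf⟩)).symm
        ψ.mapPresheaf := by
    ext U : 2
    exact key U.unop
  have := Equiv.injective _ this
  ext U : 1
  exact congr_app this (op U)

end Modules

end AlgebraicGeometry.Scheme

end

/-! ### Morphisms out of `Nil_X(F)` and fullness of `F ↦ Nil_X(F)`. -/

noncomputable section

namespace AlgebraicGeometry.Scheme.Modules

open PointedOver

variable {X : Scheme.{u}}

theorem section_ext_affine (F : X.Modules) {U : X.Opens} {s t : Γ(F, U)}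
    (h : ∀ (V : X.AffineZariskiSite) (i : V.toOpens ≤ U),
      F.presheaf.map (homOfLE i).op s = F.presheaf.map (homOfLE i).op t) : s = t := by
  refine TopCat.Presheaf.IsSheaf.section_ext F.isSheaf fun x hx ↦ ?_
  obtain ⟨_, ⟨V, hV, rfl⟩, hxV, hVU⟩ := X.isBasis_affineOpens.exists_subset_of_mem_open hx U.2
  exact ⟨V, hVU, hxV, h ⟨V, hV⟩ hVU⟩

/-- A family of homomorphisms of augmented algebras `𝒪_X ⊕ F → 𝒪_X ⊕ G` over the affine opens is
induced by a homomorphism of modules. -/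
theorem exists_symLeOneMap_eq {F G : X.Modules}
    (τ : ∀ U : X.AffineZariskiSite, F.symLeOne.obj (op U.toOpens) ⟶ G.symLeOne.obj (op U.toOpens))
    (hτ : ∀ {U V : X.AffineZariskiSite} (i : U ⟶ V),
      F.symLeOne.map ((AffineZariskiSite.toOpensFunctor X).map i).op ≫ τ U =
        τ V ≫ G.symLeOne.map ((AffineZariskiSite.toOpensFunctor X).map i).op)
    (hunit : ∀ U, F.symLeOneUnit.app (op U.toOpens) ≫ τ U = G.symLeOneUnit.app (op U.toOpens))
    (haug : ∀ U, τ U ≫ G.symLeOneAug.app (op U.toOpens) = F.symLeOneAug.app (op U.toOpens)) :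
    ∃ φ : F ⟶ G, ∀ U : X.AffineZariskiSite, (symLeOneMap φ).app (op U.toOpens) = τ U := by
  have h₁ (U : X.AffineZariskiSite) (r : Γ(X, U.toOpens)) :
      τ U (TrivSqZeroExt.inl r) = TrivSqZeroExt.inl r :=
    ConcreteCategory.congr_hom (hunit U) r
  have h₂ (U : X.AffineZariskiSite) (x : TrivSqZeroExt Γ(X, U.toOpens) Γ(F, U.toOpens)) :
      TrivSqZeroExt.fst (R := Γ(X, U.toOpens)) (M := Γ(G, U.toOpens)) (τ U x) =
        TrivSqZeroExt.fst x :=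
    ConcreteCategory.congr_hom (haug U) x
  -- Compatibility with the augmentations keeps `inr m` inside the square-zero summand, so this
  -- second component carries all the information.
  let g (U : X.AffineZariskiSite) (m : Γ(F, U.toOpens)) : Γ(G, U.toOpens) :=
    TrivSqZeroExt.snd (R := Γ(X, U.toOpens)) (τ U (TrivSqZeroExt.inr m))
  have h₃ (U : X.AffineZariskiSite) (m : Γ(F, U.toOpens)) :
      τ U (TrivSqZeroExt.inr m) = TrivSqZeroExt.inr (g U m) :=
    TrivSqZeroExt.ext (h₂ U _) rfl
  have h₄ (U : X.AffineZariskiSite) (r : Γ(X, U.toOpens)) (m : Γ(F, U.toOpens)) :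
      g U (r • m) = r • g U m := by
    refine TrivSqZeroExt.inr_injective (R := Γ(X, U.toOpens)) ?_
    rw [← h₃, ← TrivSqZeroExt.inl_mul_inr, ← TrivSqZeroExt.inl_mul_inr, ← h₃]
    exact (map_mul (τ U).hom _ _).trans (congrArg (· * _) (h₁ U r))
  have h₅ (U : X.AffineZariskiSite) (m m' : Γ(F, U.toOpens)) : g U (m + m') = g U m + g U m' := by
    refine TrivSqZeroExt.inr_injective (R := Γ(X, U.toOpens)) ?_
    rw [TrivSqZeroExt.inr_add, ← h₃, ← h₃, ← h₃, TrivSqZeroExt.inr_add]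
    exact map_add (τ U).hom _ _
  let α : (AffineZariskiSite.toOpensFunctor X).op ⋙ F.presheaf ⟶
      (AffineZariskiSite.toOpensFunctor X).op ⋙ G.presheaf :=
    { app U := AddCommGrpCat.ofHom (AddMonoidHom.mk' (g U.unop) (h₅ U.unop))
      naturality U V i := by
        ext m
        refine TrivSqZeroExt.inr_injective (R := Γ(X, V.unop.toOpens)) ?_
        refine (h₃ _ _).symm.trans ?_
        have := ConcreteCategory.congr_hom (hτ i.unop) (TrivSqZeroExt.inr m)
        refine Eq.trans ?_ (this.trans ?_)
        · refine congrArg (τ V.unop) (TrivSqZeroExt.ext ?_ rfl)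
          exact (map_zero (X.presheaf.map _).hom).symm
        · refine (congrArg (G.symLeOne.map _) (h₃ _ _)).trans (TrivSqZeroExt.ext ?_ rfl)
          exact map_zero (X.presheaf.map _).hom }
  -- Since `G` is a sheaf and the affine opens are cover-dense, the additive maps extend uniquely to
  -- all opens. Linearity of the extension is then checked on affine opens.
  let E := Functor.IsCoverDense.restrictHomEquivHom (K := Opens.grothendieckTopology X)
      (G := AffineZariskiSite.toOpensFunctor X) (ℱ := F.presheaf) (ℱ' := ⟨G.presheaf, G.isSheaf⟩)
  let ψ : F.presheaf ⟶ G.presheaf := E α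
  have hψ (U : X.AffineZariskiSite) (m : Γ(F, U.toOpens)) : ψ.app (op U.toOpens) m = g U m :=
    ConcreteCategory.congr_hom (congr_app (E.symm_apply_apply α) (op U)) m
  have hψ' {U V : X.Opens} (i : U ≤ V) (m : Γ(F, V)) :
      G.presheaf.map (homOfLE i).op (ψ.app (op V) m) =
        ψ.app (op U) (F.presheaf.map (homOfLE i).op m) :=
    (ConcreteCategory.congr_hom (ψ.naturality (homOfLE i).op) m).symm
  let φ : F ⟶ G := ⟨PresheafOfModules.homMk ψ fun U (r : Γ(X, U.unop)) (m : Γ(F, U.unop)) ↦ by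
    change ψ.app (op U.unop) (r • m) = r • (show Γ(G, U.unop) from ψ.app (op U.unop) m)
    refine section_ext_affine G fun V i ↦ ?_
    rw [hψ', G.map_smul, hψ', F.map_smul, hψ, hψ, h₄]⟩
  refine ⟨φ, fun U ↦ ?_⟩
  ext x
  obtain ⟨r, m, rfl⟩ : ∃ r m, x = TrivSqZeroExt.inl r + TrivSqZeroExt.inr m :=
    ⟨_, _, (TrivSqZeroExt.inl_fst_add_inr_snd_eq x).symm⟩
  refine Eq.trans ?_ (map_add (τ U).hom _ _).symm
  refine Eq.trans ?_ (congrArg₂ (· + ·) (h₁ U r) (h₃ U m)).symm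
  refine TrivSqZeroExt.ext ?_ ?_
  · exact (TrivSqZeroExt.fst_add _ _).trans (TrivSqZeroExt.fst_add _ _).symm
  · refine Eq.trans ?_ (TrivSqZeroExt.snd_add _ _).symm
    change ψ.app (op U.toOpens) (0 + m) = 0 + g U m
    rw [zero_add, zero_add, hψ]

/-- A morphism from `Nil_X(F)` to an object that is affine over `X` is given by compatible
homomorphisms of augmented algebras over the affine opens of `X`. -/
theorem exists_pull_nilRing_eq (F : X.Modules) [F.IsQuasicoherent] (Y : X.PointedOver)
    [IsAffineHom Y.toBase]
    (τ : ∀ U : X.AffineZariskiSite, Y.sections U.toOpens ⟶ F.symLeOne.obj (op U.toOpens))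
    (hτ : ∀ {U V : X.AffineZariskiSite} (i : U ⟶ V),
      Y.res ((AffineZariskiSite.toOpensFunctor X).map i) ≫ τ U =
        τ V ≫ F.symLeOne.map ((AffineZariskiSite.toOpensFunctor X).map i).op)
    (hunit : ∀ U, Y.unit U.toOpens ≫ τ U = F.symLeOneUnit.app (op U.toOpens))
    (haug : ∀ U, τ U ≫ F.symLeOneAug.app (op U.toOpens) = Y.aug U.toOpens) :
    ∃ m : F.nilPointed ⟶ Y, ∀ U, pull m U.toOpens ≫ F.nilRing U = τ U := by
  have hres {U V : X.AffineZariskiSite} (i : U ⟶ V) :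
      Spec.map (Y.res ((AffineZariskiSite.toOpensFunctor X).map i)) ≫ (Y.isAffineOpen V).fromSpec =
        (Y.isAffineOpen U).fromSpec :=
    (Y.isAffineOpen V).map_fromSpec (Y.isAffineOpen U) _
  let m : F.nilPointed.scheme ⟶ Y.scheme := colimit.desc F.nilGluingData.functor
    { pt := Y.scheme
      ι :=
        { app U := Spec.map (τ U) ≫ (Y.isAffineOpen U).fromSpec
          naturality U V i := by
            refine Eq.trans ?_ (Category.comp_id _).symm
            refine Eq.trans ?_ (congrArg (Spec.map (τ U) ≫ ·) (hres i))
            refine (Spec.map_comp_assoc _ _ _).symm.trans ?_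
            refine Eq.trans ?_ (Spec.map_comp_assoc _ _ _)
            exact congrArg (Spec.map · ≫ _) (hτ i).symm } }
  have hm (U : X.AffineZariskiSite) :
      F.nilChart U ≫ m = Spec.map (τ U) ≫ (Y.isAffineOpen U).fromSpec :=
    colimit.ι_desc _ U
  have h₁ : m ≫ Y.toBase = F.nilPointed.toBase := by
    refine F.nil_hom_ext fun U ↦ ?_
    change F.nilChart U ≫ m ≫ Y.toBase = F.nilChart U ≫ F.nilPointed.toBase
    have e : (Y.isAffineOpen U).fromSpec ≫ Y.toBase = Spec.map (Y.unit U.toOpens) ≫ U.2.fromSpec := by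
      rw [PointedOver.unit, Hom.app_eq_appLE, IsAffineOpen.SpecMap_appLE_fromSpec]
    rw [← Category.assoc, hm, Category.assoc, e, nilChart_toBase, ← Spec.map_comp_assoc, hunit]
  have h₂ : F.nilPointed.sec ≫ m = Y.sec := by
    refine (AffineZariskiSite.isColimitCocone X).hom_ext fun U ↦ ?_
    change U.2.fromSpec ≫ F.nilPointed.sec ≫ m = U.2.fromSpec ≫ Y.sec
    rw [← Category.assoc, fromSpec_sec, Category.assoc, hm, ← Spec.map_comp_assoc, haug]
    exact IsAffineOpen.SpecMap_appLE_fromSpec ..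
  refine ⟨homMk m h₁ h₂, fun U ↦ ?_⟩
  have h : ⊤ ≤ (Y.isAffineOpen U).fromSpec ⁻¹ᵁ (Y.toBase ⁻¹ᵁ U.toOpens) := by simp
  rw [nilRing, pull_toRing]
  refine (toRing_congr (hm U) _).trans ((toRing_specMap_comp _ h _).trans ?_)
  exact (congrArg (· ≫ τ U) (fromSpec_appLE_ΓSpecIso (Y.isAffineOpen U) h)).trans
    (Category.id_comp _)

/-- Needed for fullness: the algebra map attached to a morphism is conjugated by the chart
isomorphisms, and its compatibility with restriction comes from pasting three naturality squares. -/
theorem inv_conj_naturality {C : Type*} [Category* C] {P P' Q Q' R R' S S' : C}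
    {ρ : P ⟶ P'} [IsIso ρ] {ρ' : Q ⟶ Q'} [IsIso ρ'] {r : P ⟶ Q} {r' : P' ⟶ Q'}
    (h₁ : r ≫ ρ' = ρ ≫ r') {p : P ⟶ R} {q : Q ⟶ S} {s : R ⟶ S} (h₂ : r ≫ q = p ≫ s)
    {σ : R ⟶ R'} {σ' : S ⟶ S'} {s' : R' ⟶ S'} (h₃ : s ≫ σ' = σ ≫ s') :
    r' ≫ inv ρ' ≫ q ≫ σ' = (inv ρ ≫ p ≫ σ) ≫ s' := by
  rw [← cancel_epi ρ, ← reassoc_of% h₁, IsIso.hom_inv_id_assoc, reassoc_of% h₂, h₃]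
  simp

/-- The functor `F ↦ Nil_X(F)` to `X/Sch_X` is full. -/
theorem exists_nilPointedMap_eq {F G : X.Modules} [F.IsQuasicoherent] [G.IsQuasicoherent]
    (h : G.nilPointed ⟶ F.nilPointed) : ∃ φ : F ⟶ G, nilPointedMap φ = h := by
  obtain ⟨φ, hφ⟩ := exists_symLeOneMap_eq (F := F) (G := G)
    (fun U ↦ inv (F.nilRing U) ≫ pull h U.toOpens ≫ G.nilRing U)
    (fun {U V} i ↦ inv_conj_naturality (ρ := F.nilRing V) (ρ' := F.nilRing U) (res_nilRing F i) (res_pull h _) (res_nilRing G i))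
    (fun U ↦ by
      rw [← unit_nilRing, Category.assoc, IsIso.hom_inv_id_assoc, ← Category.assoc, unit_pull,
        unit_nilRing])
    (fun U ↦ by
      rw [← cancel_epi (F.nilRing U), Category.assoc, Category.assoc, IsIso.hom_inv_id_assoc,
        nilRing_aug, nilRing_aug, pull_aug])
  refine ⟨φ, hom_ext_pull fun U ↦ ?_⟩
  rw [← cancel_mono (G.nilRing U), pull_nilRing, hφ, IsIso.hom_inv_id_assoc]

/-! ### Functions on `Nil_X(F ⊕ F)`. -/

/-- The sections of `Nil_X(F ⊕ F)` are sums of sections of the two copies of `Nil_X(F)`. -/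
theorem exists_eq_pull_inl_add_pull_inr (F : X.Modules) [F.IsQuasicoherent]
    (U : X.AffineZariskiSite) (w : (F ⊞ F).nilPointed.sections U.toOpens) :
    ∃ a b : F.nilPointed.sections U.toOpens,
      w = pull (nilPointedMap biprod.inl) U.toOpens a +
        pull (nilPointedMap biprod.inr) U.toOpens b := by
  let ρ := F.nilRing U
  let ρ₂ := (F ⊞ F).nilRing U
  let x : TrivSqZeroExt Γ(X, U.toOpens) Γ(F ⊞ F, U.toOpens) := ρ₂ w
  -- The constant part `x.fst` is assigned to `a` alone, since the sum would otherwise count it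
  -- twice.
  let a : F.symLeOne.obj (op U.toOpens) :=
    TrivSqZeroExt.inl x.fst + TrivSqZeroExt.inr ((biprod.fst : F ⊞ F ⟶ F).app _ x.snd)
  let b : F.symLeOne.obj (op U.toOpens) :=
    TrivSqZeroExt.inr ((biprod.snd : F ⊞ F ⟶ F).app _ x.snd)
  have key (ι : F ⟶ F ⊞ F) (z : F.symLeOne.obj (op U.toOpens)) :
      ρ₂ (pull (nilPointedMap ι) U.toOpens (inv ρ z)) =
        (symLeOneMap ι).app (op U.toOpens) z := by
    have := ConcreteCategory.congr_hom (pull_nilRing ι U) (inv ρ z)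
    refine this.trans ?_
    have hz : ρ (inv ρ z) = z := ConcreteCategory.congr_hom (IsIso.inv_hom_id ρ) z
    exact congrArg ((symLeOneMap ι).app (op U.toOpens)) hz
  refine ⟨inv ρ a, inv ρ b, ?_⟩
  refine ((ConcreteCategory.isIso_iff_bijective ρ₂).mp inferInstance).1 ?_
  refine Eq.trans ?_ (map_add ρ₂.hom _ _).symm
  refine Eq.trans ?_ (congrArg₂ (· + ·) (key biprod.inl a) (key biprod.inr b)).symm
  have htot : (biprod.inl : F ⟶ F ⊞ F).app U.toOpens ((biprod.fst : F ⊞ F ⟶ F).app _ x.snd) +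
      (biprod.inr : F ⟶ F ⊞ F).app U.toOpens ((biprod.snd : F ⊞ F ⟶ F).app _ x.snd) = x.snd := by
    have := congrArg (fun φ : F ⊞ F ⟶ F ⊞ F ↦ φ.app U.toOpens x.snd) (biprod.total (X := F) (Y := F))
    exact this
  refine TrivSqZeroExt.ext ?_ ?_
  · change x.fst = (x.fst + 0) + 0
    simp
  · change x.snd = (biprod.inl : F ⟶ F ⊞ F).app U.toOpens
        (0 + (biprod.fst : F ⊞ F ⟶ F).app _ x.snd) +
      (biprod.inr : F ⟶ F ⊞ F).app U.toOpens ((biprod.snd : F ⊞ F ⟶ F).app _ x.snd)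
    rw [zero_add, htot]

section

variable (F : X.Modules) [F.IsQuasicoherent] (U : X.AffineZariskiSite)

theorem pull_fst_pull_inl (a : F.nilPointed.sections U.toOpens) :
    pull (nilPointedMap (biprod.fst : F ⊞ F ⟶ F)) U.toOpens
      (pull (nilPointedMap biprod.inl) U.toOpens a) = a := by
  rw [← pull_comp_apply, ← nilPointedMap_comp, biprod.inl_fst, nilPointedMap_id, pull_id_apply]

theorem pull_fst_pull_inr (a : F.nilPointed.sections U.toOpens) :
    pull (nilPointedMap (biprod.fst : F ⊞ F ⟶ F)) U.toOpens
      (pull (nilPointedMap biprod.inr) U.toOpens a) =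
      F.nilPointed.unit U.toOpens (F.nilPointed.aug U.toOpens a) := by
  rw [← pull_comp_apply, ← nilPointedMap_comp, biprod.inr_fst, nilPointedMap_zero,
    pull_trivialHom_apply]

theorem pull_snd_pull_inl (a : F.nilPointed.sections U.toOpens) :
    pull (nilPointedMap (biprod.snd : F ⊞ F ⟶ F)) U.toOpens
      (pull (nilPointedMap biprod.inl) U.toOpens a) =
      F.nilPointed.unit U.toOpens (F.nilPointed.aug U.toOpens a) := by
  rw [← pull_comp_apply, ← nilPointedMap_comp, biprod.inl_snd, nilPointedMap_zero,
    pull_trivialHom_apply]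

theorem pull_snd_pull_inr (a : F.nilPointed.sections U.toOpens) :
    pull (nilPointedMap (biprod.snd : F ⊞ F ⟶ F)) U.toOpens
      (pull (nilPointedMap biprod.inr) U.toOpens a) = a := by
  rw [← pull_comp_apply, ← nilPointedMap_comp, biprod.inr_snd, nilPointedMap_id, pull_id_apply]

/-- A section of `Nil_X(F ⊕ F)` is determined by its restrictions to the two copies of
`Nil_X(F)`. -/
theorem eq_zero_of_pull_fst_of_pull_snd {w : (F ⊞ F).nilPointed.sections U.toOpens}
    (h₁ : pull (nilPointedMap (biprod.fst : F ⊞ F ⟶ F)) U.toOpens w = 0)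
    (h₂ : pull (nilPointedMap (biprod.snd : F ⊞ F ⟶ F)) U.toOpens w = 0) : w = 0 := by
  obtain ⟨a, b, rfl⟩ := exists_eq_pull_inl_add_pull_inr F U w
  rw [map_add, pull_fst_pull_inl, pull_fst_pull_inr] at h₁
  rw [map_add, pull_snd_pull_inl, pull_snd_pull_inr] at h₂
  -- The vanishing restrictions make `a` and `b` constants, equal to minus the augmentation of the
  -- other. It remains that the two constants cancel.
  have h₃ := congrArg (F.nilPointed.aug U.toOpens) h₁
  rw [map_add, aug_unit_apply, map_zero] at h₃
  have ha : pull (nilPointedMap (biprod.inl : F ⟶ F ⊞ F)) U.toOpens a =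
      -(F ⊞ F).nilPointed.unit U.toOpens (F.nilPointed.aug U.toOpens b) := by
    rw [eq_neg_of_add_eq_zero_left h₁, map_neg, pull_unit_apply]
  have hb : pull (nilPointedMap (biprod.inr : F ⟶ F ⊞ F)) U.toOpens b =
      -(F ⊞ F).nilPointed.unit U.toOpens (F.nilPointed.aug U.toOpens a) := by
    rw [eq_neg_of_add_eq_zero_right h₂, map_neg, pull_unit_apply]
  rw [ha, hb, ← neg_add, ← map_add, add_comm, h₃, map_zero, neg_zero]

/-- A pair of sections of `Nil_X(F)` with the same restriction to `X` comes from
`Nil_X(F ⊕ F)`. -/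
theorem exists_pull_fst_eq_and_pull_snd_eq {a b : F.nilPointed.sections U.toOpens}
    (h : F.nilPointed.aug U.toOpens a = F.nilPointed.aug U.toOpens b) :
    ∃ w : (F ⊞ F).nilPointed.sections U.toOpens,
      pull (nilPointedMap (biprod.fst : F ⊞ F ⟶ F)) U.toOpens w = a ∧
      pull (nilPointedMap (biprod.snd : F ⊞ F ⟶ F)) U.toOpens w = b := by
  -- Each restriction of the sum is off by the common augmentation of `a` and `b`, hence the
  -- correction by that constant.
  refine ⟨pull (nilPointedMap biprod.inl) U.toOpens a + pull (nilPointedMap biprod.inr) U.toOpens b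
    - (F ⊞ F).nilPointed.unit U.toOpens (F.nilPointed.aug U.toOpens a), ?_, ?_⟩
  · rw [map_sub, map_add, pull_fst_pull_inl, pull_fst_pull_inr, pull_unit_apply, h,
      add_sub_cancel_right]
  · rw [map_sub, map_add, pull_snd_pull_inl, pull_snd_pull_inr, pull_unit_apply,
      add_sub_cancel_left]

end

end AlgebraicGeometry.Scheme.Modules

end

/-! ### Consequences of the counit law: the section is onto, the ideal has square zero. -/

noncomputable section

namespace AlgebraicGeometry.Scheme

variable {X : Scheme.{u}}

namespace PointedOver

theorem isHomeomorph_toBase (Y : X.PointedOver) (h : Function.Surjective Y.sec) :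
    IsHomeomorph Y.toBase := by
  have hs (x : X) : Y.toBase (Y.sec x) = x := by
    rw [← Hom.comp_apply, sec_toBase]
    rfl
  refine isHomeomorph_iff_exists_inverse.mpr
    ⟨Y.toBase.continuous, Y.sec, fun y ↦ ?_, hs, Y.sec.continuous⟩
  obtain ⟨x, rfl⟩ := h y
  rw [hs]

/-- A morphism of schemes that is a topological embedding with closed range is affine, and a
homeomorphism is one. -/
theorem isAffineHom_toBase (Y : X.PointedOver) (h : Function.Surjective Y.sec) :
    IsAffineHom Y.toBase := by
  have := Y.isHomeomorph_toBase h
  exact isAffineHom_of_isInducing _ this.isInducing this.isClosedMap.isClosed_range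

theorem isAffineHom_schemeHom {Y T : X.PointedOver} [IsAffineHom Y.toBase] [IsAffineHom T.toBase]
    (f : Y ⟶ T) : IsAffineHom (schemeHom f) := by
  have : IsAffineHom (schemeHom f ≫ T.toBase) := by rwa [schemeHom_toBase]
  exact .of_comp _ T.toBase

theorem section_ext_affine (Y : X.PointedOver) {U : X.Opens} {s t : Y.sections U}
    (h : ∀ (V : X.AffineZariskiSite) (i : V.toOpens ≤ U),
      Y.res (homOfLE i) s = Y.res (homOfLE i) t) : s = t := by
  refine TopCat.Presheaf.IsSheaf.section_ext Y.scheme.sheaf.2 fun y hy ↦ ?_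
  obtain ⟨_, ⟨V, hV, rfl⟩, hyV, hVU⟩ :=
    X.isBasis_affineOpens.exists_subset_of_mem_open (show Y.toBase y ∈ U from hy) U.2
  exact ⟨Y.toBase ⁻¹ᵁ V, Y.toBase.preimage_mono hVU, hyV, h ⟨V, hV⟩ hVU⟩

/-- In an affine-over-`X` coproduct of affine-over-`X` objects, a section is determined by its
restrictions to the summands. -/
theorem eq_zero_of_isColimit {Y Z : X.PointedOver} [IsAffineHom Y.toBase]
    [IsAffineHom Z.toBase] {l r : Y ⟶ Z} (h : IsColimit (BinaryCofan.mk l r))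
    (U : X.AffineZariskiSite) {w : Z.sections U.toOpens}
    (hl : pull l U.toOpens w = 0) (hr : pull r U.toOpens w = 0) : w = 0 := by
  have hla := isAffineHom_schemeHom l
  have hra := isAffineHom_schemeHom r
  -- `I` cuts out the smallest closed subscheme through which both `l` and `r` factor, and `w`
  -- vanishes on it. The universal property will show that this subscheme is all of `Z`.
  let I : Z.scheme.IdealSheafData := (schemeHom l).ker ⊓ (schemeHom r).ker
  let V : Z.scheme.affineOpens := ⟨Z.toBase ⁻¹ᵁ U.toOpens, Z.isAffineOpen U⟩
  have key (f : Y ⟶ Z) [IsAffineHom (schemeHom f)] (hf : pull f U.toOpens w = 0) :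
      w ∈ (schemeHom f).ker.ideal V := by
    rw [Hom.ker_apply]
    have e : schemeHom f ⁻¹ᵁ (Z.toBase ⁻¹ᵁ U.toOpens) = Y.toBase ⁻¹ᵁ U.toOpens := by
      rw [← Hom.comp_preimage, schemeHom_toBase]
    have : pull f U.toOpens = (schemeHom f).app _ ≫ Y.scheme.presheaf.map (eqToHom e.symm).op := by
      rw [Hom.app_eq_appLE, Hom.appLE_map, pull]
    rw [this] at hf
    refine ((ConcreteCategory.isIso_iff_bijective
      (Y.scheme.presheaf.map (eqToHom e.symm).op)).mp inferInstance).1 ?_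
    exact hf.trans (map_zero _).symm
  have hw : w ∈ I.ideal V := ⟨key l hl, key r hr⟩
  let l' := IsClosedImmersion.lift I.subschemeι (schemeHom l) (I.ker_subschemeι.le.trans inf_le_left)
  let r' := IsClosedImmersion.lift I.subschemeι (schemeHom r)
    (I.ker_subschemeι.le.trans inf_le_right)
  have hl' : l' ≫ I.subschemeι = schemeHom l := IsClosedImmersion.lift_fac ..
  have hr' : r' ≫ I.subschemeι = schemeHom r := IsClosedImmersion.lift_fac ..
  have hsec : (Y.sec ≫ l') ≫ I.subschemeι = Z.sec := by
    rw [Category.assoc, hl', sec_schemeHom]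
  have hsec' : Y.sec ≫ r' = Y.sec ≫ l' := by
    rw [← cancel_mono I.subschemeι, hsec, Category.assoc, hr', sec_schemeHom]
  let S : X.PointedOver := .mk I.subscheme (I.subschemeι ≫ Z.toBase) (Y.sec ≫ l') (by
    rw [← Category.assoc, hsec, sec_toBase])
  let ι : S ⟶ Z := homMk I.subschemeι rfl hsec
  let lS : Y ⟶ S := homMk l' ((Category.assoc ..).symm.trans
    ((congrArg (· ≫ _) hl').trans (schemeHom_toBase l))) rfl
  let rS : Y ⟶ S := homMk r' ((Category.assoc ..).symm.trans
    ((congrArg (· ≫ _) hr').trans (schemeHom_toBase r))) hsec'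
  -- The factorizations through `S` glue to a morphism splitting `S → Z`: both `ρ ≫ ι` and the
  -- identity restrict to `l` and `r`. So pullback to `S` is injective.
  let ρ : Z ⟶ S := h.desc (BinaryCofan.mk lS rS)
  have hρ : ρ ≫ ι = 𝟙 Z := by
    refine BinaryCofan.IsColimit.hom_ext h ?_ ?_
    · change l ≫ ρ ≫ ι = l ≫ 𝟙 Z
      rw [← Category.assoc, show l ≫ ρ = lS from h.fac _ ⟨WalkingPair.left⟩, Category.comp_id]
      exact hom_ext_schemeHom hl'
    · change r ≫ ρ ≫ ι = r ≫ 𝟙 Z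
      rw [← Category.assoc, show r ≫ ρ = rS from h.fac _ ⟨WalkingPair.right⟩, Category.comp_id]
      exact hom_ext_schemeHom hr'
  have hι : pull ι U.toOpens w = 0 := by
    have : I.subschemeι.app V.1 w = 0 := by
      rwa [← RingHom.mem_ker, I.ker_subschemeι_app]
    change (I.subschemeι.app V.1 ≫ I.subscheme.presheaf.map _) w = 0
    exact (congrArg _ this).trans (map_zero (I.subscheme.presheaf.map _).hom)
  rw [← pull_id_apply Z U.toOpens w, ← hρ, pull_comp_apply, hι, map_zero]

end PointedOver

namespace CogroupData

open PointedOver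

variable (D : CogroupData X) (h : IsColimit (BinaryCofan.mk D.inl D.inr))

/-- The morphism `[f, g] : Y ⨿_X Y → T`. -/
def desc {T : X.PointedOver} (f g : D.obj ⟶ T) : D.coprod ⟶ T :=
  h.desc (BinaryCofan.mk f g)

theorem inl_desc {T : X.PointedOver} (f g : D.obj ⟶ T) :
    D.inl ≫ D.desc h f g = f :=
  h.fac _ ⟨WalkingPair.left⟩

theorem inr_desc {T : X.PointedOver} (f g : D.obj ⟶ T) :
    D.inr ≫ D.desc h f g = g :=
  h.fac _ ⟨WalkingPair.right⟩

/-- If `c y` is in the left copy, apply `[trivial, id]`: it returns `y` by the counit law, but it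
maps the left copy into the section. The right copy is symmetric, with `[id, trivial]`. -/
theorem surjective_sec
    (hcounit : ∀ {T : X.PointedOver} (f : D.obj ⟶ T), D.conv h (D.obj.trivialHom T) f = f ∧
      D.conv h f (D.obj.trivialHom T) = f)
    (hset : ∀ z : D.coprod.scheme,
      (∃ y, schemeHom D.inl y = z) ∨ ∃ y, schemeHom D.inr y = z) :
    Function.Surjective D.obj.sec := by
  intro y
  have key {f g : D.obj ⟶ D.obj} (hfg : D.conv h f g = 𝟙 _) :
      schemeHom (D.desc h f g) (schemeHom D.comul y) = y := by
    have : schemeHom D.comul ≫ schemeHom (D.desc h f g) = 𝟙 _ :=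
      congrArg schemeHom hfg
    rw [← Hom.comp_apply, this]
    rfl
  have triv {f : D.obj ⟶ D.coprod} {g : D.coprod ⟶ D.obj} (hfg : f ≫ g = trivialHom _ _)
      (y' : D.obj.scheme) : schemeHom g (schemeHom f y') = D.obj.sec (D.obj.toBase y') := by
    have : schemeHom f ≫ schemeHom g = D.obj.toBase ≫ D.obj.sec := congrArg schemeHom hfg
    rw [← Hom.comp_apply, this, Hom.comp_apply]
  obtain ⟨y', hy'⟩ | ⟨y', hy'⟩ := hset (schemeHom D.comul y)
  · refine ⟨D.obj.toBase y', ?_⟩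
    rw [← key (hcounit (𝟙 _)).1, ← hy', triv (D.inl_desc h _ _)]
  · refine ⟨D.obj.toBase y', ?_⟩
    rw [← key (hcounit (𝟙 _)).2, ← hy', triv (D.inr_desc h _ _)]

theorem surjective_sec_coprod (hD : Function.Surjective D.obj.sec)
    (hset : ∀ z : D.coprod.scheme,
      (∃ y, schemeHom D.inl y = z) ∨ ∃ y, schemeHom D.inr y = z) :
    Function.Surjective D.coprod.sec := by
  have key (f : D.obj ⟶ D.coprod) (y) : ∃ x, D.coprod.sec x = schemeHom f y := by
    obtain ⟨x, rfl⟩ := hD y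
    exact ⟨x, by rw [← Hom.comp_apply, sec_schemeHom]⟩
  intro z
  obtain ⟨y, rfl⟩ | ⟨y, rfl⟩ := hset z
  exacts [key _ y, key _ y]

/-- On the left copy the second factor of `δ₁^* a * δ₂^* b` becomes the augmentation of `b`, on the
right copy the first becomes that of `a`. So the product is zero, and `c^*` turns it into `a * b`
because `c` is split by `δ₁` and by `δ₂`. No coassociativity or inverse enters. -/
theorem mul_eq_zero_of_aug_eq_zero [IsAffineHom D.obj.toBase] [IsAffineHom D.coprod.toBase]
    (hcounit : ∀ {T : X.PointedOver} (f : D.obj ⟶ T), D.conv h (D.obj.trivialHom T) f = f ∧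
      D.conv h f (D.obj.trivialHom T) = f)
    (U : X.Opens) {a b : D.obj.sections U} (ha : D.obj.aug U a = 0) (hb : D.obj.aug U b = 0) :
    a * b = 0 := by
  have key (V : X.AffineZariskiSite) (a b : D.obj.sections V.toOpens)
      (ha : D.obj.aug _ a = 0) (hb : D.obj.aug _ b = 0) : a * b = 0 := by
    let δ₁ := D.desc h (𝟙 D.obj) (trivialHom D.obj D.obj)
    let δ₂ := D.desc h (trivialHom D.obj D.obj) (𝟙 D.obj)
    have h₁ : D.comul ≫ δ₁ = 𝟙 _ := (hcounit (𝟙 _)).2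
    have h₂ : D.comul ≫ δ₂ = 𝟙 _ := (hcounit (𝟙 _)).1
    have hw : pull δ₁ V.toOpens a * pull δ₂ V.toOpens b = 0 := by
      refine eq_zero_of_isColimit h V ?_ ?_
      · rw [map_mul, ← pull_comp_apply, ← pull_comp_apply, D.inl_desc h, D.inl_desc h,
          pull_trivialHom_apply, hb, map_zero, mul_zero]
      · rw [map_mul, ← pull_comp_apply, ← pull_comp_apply, D.inr_desc h, D.inr_desc h,
          pull_trivialHom_apply, ha, map_zero, zero_mul]
    have := congrArg (pull D.comul V.toOpens) hw
    rwa [map_mul, ← pull_comp_apply, ← pull_comp_apply, h₁, h₂, pull_id_apply, pull_id_apply,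
      map_zero] at this
  refine section_ext_affine _ fun V i ↦ ?_
  have haug (c : D.obj.sections U) (hc : D.obj.aug U c = 0) :
      D.obj.aug V.toOpens (D.obj.res (homOfLE i) c) = 0 := by
    refine (ConcreteCategory.congr_hom (D.obj.res_aug (homOfLE i)) c).trans ?_
    exact (congrArg (X.presheaf.map _) hc).trans (map_zero (X.presheaf.map _).hom)
  rw [map_mul, map_zero]
  exact key V _ _ (haug a ha) (haug b hb)

end CogroupData

end AlgebraicGeometry.Scheme

end

/-! ### The augmentation ideal as an `𝒪_X`-module. -/

noncomputable section

namespace AlgebraicGeometry.Scheme.PointedOver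

variable {X : Scheme.{u}} (Y : X.PointedOver)

/-- The sheaf `p_* 𝒪_Y` as a module over `𝒪_X`. -/
def pushforwardModule : X.Modules :=
  (Modules.pushforward Y.toBase).obj (SheafOfModules.unit Y.scheme.ringCatSheaf)

/-- The sheaf `𝒪_X` as a module over itself. -/
def unitModule (X : Scheme.{u}) : X.Modules := SheafOfModules.unit X.ringCatSheaf

/-- The augmentation `p_* 𝒪_Y → 𝒪_X` as a homomorphism of modules. -/
def augHom : Y.pushforwardModule ⟶ unitModule X :=
  ⟨PresheafOfModules.homMk
    (M₁ := Y.pushforwardModule.val) (M₂ := (unitModule X).val)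
    { app U := AddCommGrpCat.ofHom (Y.aug U.unop).hom.toAddMonoidHom
      naturality U V i := by
        ext a
        exact ConcreteCategory.congr_hom (Y.res_aug i.unop) a }
    fun U (r : Γ(X, U.unop)) (a : Y.sections U.unop) ↦ by
      change Y.aug U.unop (Y.unit U.unop r * a) = r * Y.aug U.unop a
      rw [map_mul, aug_unit_apply]⟩

/-- The augmentation ideal `ker (p_* 𝒪_Y → 𝒪_X)` as a module over `𝒪_X`. -/
def augModule : X.Modules := kernel Y.augHom

/-- The inclusion of the augmentation ideal in `p_* 𝒪_Y` on sections. -/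
def augι (U : X.Opens) : Γ(Y.augModule, U) →+ Y.sections U :=
  AddCommGrpCat.Hom.hom ((kernel.ι Y.augHom).app U)

theorem augι_smul (U : X.Opens) (r : Γ(X, U)) (m : Γ(Y.augModule, U)) :
    Y.augι U (r • m) = Y.unit U r * Y.augι U m :=
  (kernel.ι Y.augHom).app_smul r m

theorem res_augι {U V : X.Opens} (i : U ⟶ V) (m : Γ(Y.augModule, V)) :
    Y.res i (Y.augι V m) = Y.augι U (Y.augModule.presheaf.map i.op m) :=
  (ConcreteCategory.congr_hom ((kernel.ι Y.augHom).mapPresheaf.naturality i.op) m).symm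

theorem aug_augι (U : X.Opens) (m : Γ(Y.augModule, U)) : Y.aug U (Y.augι U m) = 0 :=
  congrArg (fun φ : Y.augModule ⟶ unitModule X ↦ φ.app U m) (kernel.condition Y.augHom)

/-- The functor of sections over `U`. -/
def sectionsFunctor (U : X.Opens) : X.Modules ⥤ Ab.{u} :=
  Modules.toPresheaf X ⋙ (CategoryTheory.evaluation _ _).obj (op U)

/-- Left exactness of sections makes the abstract kernel `augModule` concrete: its sections are
exactly the elements of augmentation zero. -/
instance (U : X.Opens) : PreservesFiniteLimits (sectionsFunctor U) := by
  have h : PreservesFiniteLimits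
    ((CategoryTheory.evaluation (TopologicalSpace.Opens X)ᵒᵖ Ab.{u}).obj (op U)) := inferInstance
  exact @comp_preservesFiniteLimits _ _ _ _ _ _ (Modules.toPresheaf X) _ inferInstance h

instance (U : X.Opens) : (sectionsFunctor U).PreservesZeroMorphisms where
  map_zero _ _ := rfl

theorem augι_injective (U : X.Opens) : Function.Injective (Y.augι U) := by
  have : Mono ((sectionsFunctor U).map (kernel.ι Y.augHom)) := inferInstance
  exact (AddCommGrpCat.mono_iff_injective _).mp this

theorem exists_augι_eq (U : X.Opens) {a : Y.sections U} (ha : Y.aug U a = 0) :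
    ∃ m, Y.augι U m = a := by
  have h' : (sectionsFunctor U).map (kernel.ι Y.augHom) ≫ (sectionsFunctor U).map Y.augHom = 0 := by
    rw [← Functor.map_comp, kernel.condition, Functor.map_zero]
  have h := isLimitForkMapOfIsLimit' (sectionsFunctor U) (kernel.condition Y.augHom)
    (kernelIsKernel Y.augHom)
  have := ShortComplex.exact_of_f_is_kernel (.mk _ _ h') h
  exact (ShortComplex.ab_exact_iff _).mp this a ha

end AlgebraicGeometry.Scheme.PointedOver

end

/-! ### Quasi-coherence of the augmentation ideal. -/

noncomputable section

namespace AlgebraicGeometry.Scheme.Modules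

variable {X : Scheme.{u}}

/-- A module over `Spec R` whose sections over `D(r)` are the localizations of its global sections
is quasi-coherent. -/
theorem isIso_fromTildeΓ_of_localization {R : CommRingCat.{u}} (M : (Spec R).Modules)
    (h₁ : ∀ (r : R) (V : (Spec R).Opens), V = PrimeSpectrum.basicOpen r → ∀ s : Γ(M, V),
      ∃ (n : ℕ) (t : Γ(M, ⊤)), M.presheaf.map V.leTop.op t = r ^ n • s)
    (h₂ : ∀ (r : R) (V : (Spec R).Opens), V = PrimeSpectrum.basicOpen r → ∀ t : Γ(M, ⊤),
      M.presheaf.map V.leTop.op t = 0 → ∃ n : ℕ, r ^ n • t = 0) : IsIso M.fromTildeΓ := by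
  refine (isIso_fromTildeΓ_iff_isLocalizing M).mpr fun r ↦ ⟨?_, ?_, ?_⟩
  · rintro ⟨_, n, rfl⟩
    simp only [map_pow]
    exact (isUnit_algebraMap_end_of_le_basicOpen r le_rfl).pow n
  · intro s
    obtain ⟨n, t, ht⟩ := h₁ r _ rfl s
    exact ⟨⟨t, ⟨_, n, rfl⟩⟩, ht.symm⟩
  · intro s t hst
    obtain ⟨n, hn⟩ := h₂ r _ rfl (s - t) ((map_sub (M.presheaf.map _).hom _ _).trans
      (sub_eq_zero.mpr hst))
    refine ⟨⟨_, n, rfl⟩, ?_⟩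
    change r ^ n • s = r ^ n • t
    rw [← sub_eq_zero]
    exact (smul_sub (r ^ n) s t).symm.trans hn

/-- A module whose sections over `D(r) ⊆ U` are the localizations of its sections over `U` for all
affine open `U` is quasi-coherent. -/
theorem isQuasicoherent_of_localization (F : X.Modules)
    (h₁ : ∀ (U : X.AffineZariskiSite) (r : Γ(X, U.toOpens)) (s : Γ(F, X.basicOpen r)),
      ∃ (n : ℕ) (t : Γ(F, U.toOpens)), F.presheaf.map (homOfLE (X.basicOpen_le r)).op t =
        X.presheaf.map (homOfLE (X.basicOpen_le r)).op (r ^ n) • s)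
    (h₂ : ∀ (U : X.AffineZariskiSite) (r : Γ(X, U.toOpens)) (t : Γ(F, U.toOpens)),
      F.presheaf.map (homOfLE (X.basicOpen_le r)).op t = 0 → ∃ n : ℕ, r ^ n • t = 0) :
    F.IsQuasicoherent := by
  refine isQuasicoherent_of_affine _ fun U ↦ ?_
  have hU : IsAffineOpen U.1 := U.2
  -- Restricting along `fromSpec` yields sections over image opens, which equal `D(r)` and `U` only
  -- propositionally; hence the generalization over `V` and `W`.
  have h₁' (r : Γ(X, U.1)) (V W : X.Opens) (eV : V = X.basicOpen r) (eW : W = U.1)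
      (i : V ≤ W) (j : V ≤ U.1) (s : Γ(F, V)) : ∃ (n : ℕ) (t : Γ(F, W)),
        F.presheaf.map (homOfLE i).op t = X.presheaf.map (homOfLE j).op (r ^ n) • s := by
    subst eV eW
    exact h₁ U r s
  have h₂' (r : Γ(X, U.1)) (V W : X.Opens) (eV : V = X.basicOpen r) (eW : W = U.1)
      (i : V ≤ W) (j : W ≤ U.1) (t : Γ(F, W)) (ht : F.presheaf.map (homOfLE i).op t = 0) :
      ∃ n : ℕ, X.presheaf.map (homOfLE j).op (r ^ n) • t = 0 := by
    subst eV eW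
    obtain ⟨n, hn⟩ := h₂ U r t ht
    refine ⟨n, ?_⟩
    rw [show X.presheaf.map (homOfLE j).op = 𝟙 _ from X.presheaf.map_id _]
    exact hn
  let ψ := hU.fromSpec
  have e₁ (r : Γ(X, U.1)) : ψ ''ᵁ PrimeSpectrum.basicOpen r = X.basicOpen r :=
    hU.fromSpec_image_basicOpen r
  have e₂ : ψ ''ᵁ ⊤ = U.1 := by simp [ψ]
  have hsmul (V : (Spec Γ(X, U.1)).Opens) (j : ψ ''ᵁ V ≤ U.1) (r : Γ(X, U.1)) (s : Γ(F.restrict ψ, V)) :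
      r • s = (X.presheaf.map (homOfLE j).op r • (show Γ(F, ψ ''ᵁ V) from s) : Γ(F, ψ ''ᵁ V)) := by
    rw [← appIso_fromSpec_inv hU V j]
    rfl
  have : IsIso (F.restrict ψ).fromTildeΓ := by
    refine isIso_fromTildeΓ_of_localization _ (fun r V hV s ↦ ?_) (fun r V hV t ht ↦ ?_)
    · have e : ψ ''ᵁ V = X.basicOpen r := by rw [hV, e₁]
      have j : ψ ''ᵁ V ≤ U.1 := e.le.trans (X.basicOpen_le r)
      obtain ⟨n, t, ht⟩ := h₁' r _ _ e e₂ (ψ.image_mono le_top) j s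
      exact ⟨n, t, ht.trans (hsmul _ j _ _).symm⟩
    · have e : ψ ''ᵁ V = X.basicOpen r := by rw [hV, e₁]
      obtain ⟨n, hn⟩ := h₂' r _ _ e e₂ (ψ.image_mono le_top) e₂.le t ht
      exact ⟨n, (hsmul _ e₂.le _ _).trans hn⟩
  let A := (modulesSpecToSheaf.obj (F.restrict ψ)).presheaf.obj (op ⊤)
  let P : (tilde A).Presentation :=
    presentationTilde.{u} _ .univ (by simp) _ (Submodule.span_eq _)
  let P' : (F.restrict ψ).Presentation :=
    @SheafOfModules.Presentation.ofIsIso.{u, u, u} _ _ _ _ _ _ _ _ (F.restrict ψ).fromTildeΓ this P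
  let i : (restrictFunctor hU.isoSpec.hom).obj ((restrictFunctor ψ).obj F) ≅
      (restrictFunctor U.1.ι).obj F :=
    (restrictFunctorComp hU.isoSpec.hom ψ).symm.app _ ≪≫
      (restrictFunctorCongr hU.isoSpec_hom_fromSpec).app _
  exact ⟨@SheafOfModules.Presentation.ofIsIso.{u, u, u} _ _ _ _ _ _ _ _ i.hom i.isIso_hom
    (presentationRestrict hU.isoSpec.hom P')⟩

end AlgebraicGeometry.Scheme.Modules

namespace AlgebraicGeometry.Scheme.PointedOver

variable {X : Scheme.{u}} (Y : X.PointedOver)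

/-- The preimage of `D(r)` is the basic open of the image of `r` inside the affine preimage of `U`.
-/
theorem isLocalization_res [IsAffineHom Y.toBase] (U : X.AffineZariskiSite) (r : Γ(X, U.toOpens)) :
    (∀ a : Y.sections (X.basicOpen r), ∃ (n : ℕ) (b : Y.sections U.toOpens),
      Y.res (homOfLE (X.basicOpen_le r)) b =
        Y.unit _ (X.presheaf.map (homOfLE (X.basicOpen_le r)).op (r ^ n)) * a) ∧
    (∀ b : Y.sections U.toOpens, Y.res (homOfLE (X.basicOpen_le r)) b = 0 →
      ∃ n : ℕ, Y.unit _ (r ^ n) * b = 0) := by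
  have hloc := (Y.isAffineOpen U).isLocalization_of_eq_basicOpen (Y.unit U.toOpens r)
    ((Opens.map Y.toBase.base).map (homOfLE (X.basicOpen_le r))) (Y.toBase.preimage_basicOpen r)
  let := ((Y.res (homOfLE (X.basicOpen_le r))).hom).toAlgebra
  have hloc : IsLocalization.Away (Y.unit U.toOpens r) (Y.sections (X.basicOpen r)) := hloc
  refine ⟨fun a ↦ ?_, fun b hb ↦ ?_⟩
  · obtain ⟨n, b, hb⟩ := IsLocalization.Away.surj (Y.unit U.toOpens r) a
    refine ⟨n, b, hb.symm.trans ?_⟩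
    rw [mul_comm, ← map_pow, ← map_pow]
    exact congrArg (· * a) (ConcreteCategory.congr_hom
      (Y.unit_res (homOfLE (X.basicOpen_le r))) (r ^ n))
  · obtain ⟨n, hn⟩ := IsLocalization.Away.exists_of_eq (S := Y.sections (X.basicOpen r))
      (Y.unit U.toOpens r) (show algebraMap (Y.sections U.toOpens) _ b = algebraMap _ _ 0 from
        hb.trans (map_zero (Y.res _).hom).symm)
    exact ⟨n, by rw [map_pow]; simpa using hn⟩

instance [IsAffineHom Y.toBase] : Y.augModule.IsQuasicoherent := by
  refine Modules.isQuasicoherent_of_localization _ (fun U r s ↦ ?_) (fun U r t ht ↦ ?_)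
  · obtain ⟨n, b, hb⟩ := (Y.isLocalization_res U r).1 (Y.augι _ s)
    -- The lift `b` need not lie in the augmentation ideal, so its constant part is removed. This
    -- does not affect the restriction to `D(r)`, where that constant part vanishes by `h₁`.
    have h₀ : Y.aug _ (b - Y.unit _ (Y.aug _ b)) = 0 := by
      rw [map_sub, aug_unit_apply, sub_self]
    have h₁ : X.presheaf.map (homOfLE (X.basicOpen_le r)).op (Y.aug _ b) = 0 := by
      refine (ConcreteCategory.congr_hom (Y.res_aug (homOfLE (X.basicOpen_le r))) b).symm.trans ?_
      refine (congrArg (Y.aug _) hb).trans ?_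
      rw [map_mul, aug_augι, mul_zero]
    obtain ⟨t, ht⟩ := Y.exists_augι_eq _ h₀
    refine ⟨n, t, Y.augι_injective _ ?_⟩
    rw [← res_augι, ht, augι_smul, map_sub, hb]
    refine (congrArg _ ?_).trans (sub_zero _)
    refine (ConcreteCategory.congr_hom (Y.unit_res (homOfLE (X.basicOpen_le r))) _).trans ?_
    exact (congrArg (Y.unit _) h₁).trans (map_zero _)
  · obtain ⟨n, hn⟩ := (Y.isLocalization_res U r).2 (Y.augι _ t) (by
      rw [res_augι, ht, map_zero])
    refine ⟨n, Y.augι_injective _ ?_⟩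
    rw [augι_smul, hn, map_zero]

end AlgebraicGeometry.Scheme.PointedOver

end

/-! ### Square-zero augmentation ideals and the isomorphism with `Nil_X(I)`. -/

noncomputable section

namespace AlgebraicGeometry.Scheme

variable {X : Scheme.{u}}

namespace PointedOver

variable (Y : X.PointedOver)

section

variable (hY : ∀ (U : X.Opens) (a b : Y.sections U), Y.aug U a = 0 → Y.aug U b = 0 → a * b = 0)

/-- The algebra homomorphism `𝒪_X ⊕ I → p_* 𝒪_Y` on sections, if the augmentation ideal `I` of `Y`
squares to zero. -/
def symLeOneToSections (U : X.Opens) : Y.augModule.symLeOne.obj (op U) ⟶ Y.sections U :=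
  CommRingCat.ofHom (R := TrivSqZeroExt Γ(X, U) Γ(Y.augModule, U))
    { toFun x := Y.unit U x.fst + Y.augι U x.snd
      map_one' := by simp
      map_zero' := by simp
      map_add' x y := by
        rw [TrivSqZeroExt.fst_add, TrivSqZeroExt.snd_add, map_add, map_add]
        ring
      map_mul' x y := by
        rw [TrivSqZeroExt.fst_mul, TrivSqZeroExt.snd_mul, op_smul_eq_smul, map_mul, map_add,
          augι_smul, augι_smul]
        -- The two products differ exactly by the product of the components in `I`, which `hY`
        -- kills.
        linear_combination
          -hY U _ _ (Y.aug_augι U x.snd) (Y.aug_augι U y.snd) }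

theorem symLeOneToSections_apply (U : X.Opens) (x : TrivSqZeroExt Γ(X, U) Γ(Y.augModule, U)) :
    Y.symLeOneToSections hY U x = Y.unit U x.fst + Y.augι U x.snd :=
  rfl

theorem symLeOneUnit_comp_symLeOneToSections (U : X.Opens) :
    Y.augModule.symLeOneUnit.app (op U) ≫ Y.symLeOneToSections hY U = Y.unit U := by
  ext r
  change Y.unit U r + Y.augι U 0 = Y.unit U r
  rw [map_zero, add_zero]

theorem symLeOneToSections_aug (U : X.Opens) :
    Y.symLeOneToSections hY U ≫ Y.aug U = Y.augModule.symLeOneAug.app (op U) := by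
  ext x
  change Y.aug U (Y.unit U (TrivSqZeroExt.fst x) + Y.augι U (TrivSqZeroExt.snd x)) =
    TrivSqZeroExt.fst x
  rw [map_add, aug_augι, aug_unit_apply, add_zero]

theorem symLeOneToSections_res {U V : X.Opens} (i : U ⟶ V) :
    Y.symLeOneToSections hY V ≫ Y.res i =
      Y.augModule.symLeOne.map i.op ≫ Y.symLeOneToSections hY U := by
  ext x
  change Y.res i (Y.unit V (TrivSqZeroExt.fst x) + Y.augι V (TrivSqZeroExt.snd x)) =
    Y.unit U (X.presheaf.map i.op (TrivSqZeroExt.fst x)) +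
      Y.augι U (Y.augModule.presheaf.map i.op (TrivSqZeroExt.snd x))
  rw [map_add, res_augι]
  exact congrArg (· + _) (ConcreteCategory.congr_hom (Y.unit_res i) _)

/-- The unit splits the augmentation, so every section is uniquely a constant plus an element of the
kernel. -/
theorem isIso_symLeOneToSections (U : X.Opens) : IsIso (Y.symLeOneToSections hY U) := by
  refine (ConcreteCategory.isIso_iff_bijective _).mpr ⟨?_, fun a ↦ ?_⟩
  · refine (injective_iff_map_eq_zero (Y.symLeOneToSections hY U).hom).mpr
      fun (x : TrivSqZeroExt Γ(X, U) Γ(Y.augModule, U)) hx ↦ ?_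
    change Y.unit U x.fst + Y.augι U x.snd = 0 at hx
    have h₁ : x.fst = 0 := by
      have := congrArg (Y.aug U) hx
      rwa [map_add, aug_augι, aug_unit_apply, add_zero, map_zero] at this
    rw [h₁, map_zero, zero_add] at hx
    exact TrivSqZeroExt.ext h₁ (Y.augι_injective U (hx.trans (map_zero _).symm))
  · obtain ⟨m, hm⟩ := Y.exists_augι_eq U (a := a - Y.unit U (Y.aug U a)) (by
      rw [map_sub, aug_unit_apply, sub_self])
    refine ⟨(show TrivSqZeroExt Γ(X, U) Γ(Y.augModule, U) from
      TrivSqZeroExt.inl (Y.aug U a) + TrivSqZeroExt.inr m), ?_⟩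
    rw [symLeOneToSections_apply]
    simp [hm]

end

/-- An object that is affine over `X` and whose augmentation ideal `I` squares to zero is
isomorphic to `Nil_X(I)`. -/
theorem nonempty_iso_nilPointed [IsAffineHom Y.toBase]
    (hY : ∀ (U : X.Opens) (a b : Y.sections U), Y.aug U a = 0 → Y.aug U b = 0 → a * b = 0) :
    Nonempty (Y ≅ Y.augModule.nilPointed) := by
  have hiso := Y.isIso_symLeOneToSections hY
  have hres {U V : X.Opens} (i : U ⟶ V) : Y.res i ≫ inv (Y.symLeOneToSections hY U) =
      inv (Y.symLeOneToSections hY V) ≫ Y.augModule.symLeOne.map i.op := by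
    rw [IsIso.eq_inv_comp, ← Category.assoc, IsIso.comp_inv_eq, symLeOneToSections_res]
  obtain ⟨m, hm⟩ := Modules.exists_pull_nilRing_eq Y.augModule Y
    (fun U ↦ inv (Y.symLeOneToSections hY U.toOpens))
    (fun i ↦ hres ((AffineZariskiSite.toOpensFunctor X).map i))
    (fun U ↦ by
      rw [← symLeOneUnit_comp_symLeOneToSections Y hY, Category.assoc, IsIso.hom_inv_id,
        Category.comp_id])
    (fun U ↦ by rw [IsIso.inv_comp_eq, symLeOneToSections_aug])
  have : IsIso m := isIso_of_pull_bijective m fun U ↦ by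
    have : IsIso (pull m U.toOpens) := by
      have : IsIso (pull m U.toOpens ≫ Y.augModule.nilRing U) := by
        rw [hm]; infer_instance
      exact IsIso.of_isIso_comp_right _ (Y.augModule.nilRing U)
    exact (ConcreteCategory.isIso_iff_bijective _).mp this
  exact ⟨(asIso m).symm⟩

end PointedOver

/-! ### Comparison of the cogroup structures. -/

namespace CogroupData

open PointedOver Modules

variable (D : CogroupData X) (h : IsColimit (BinaryCofan.mk D.inl D.inr))

theorem hom_ext_coprod (h : IsColimit (BinaryCofan.mk D.inl D.inr)) {T : X.PointedOver}
    {f g : D.coprod ⟶ T} (h₁ : D.inl ≫ f = D.inl ≫ g) (h₂ : D.inr ≫ f = D.inr ≫ g) : f = g :=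
  BinaryCofan.IsColimit.hom_ext h h₁ h₂

theorem desc_comp {T W : X.PointedOver} (f g : D.obj ⟶ T) (t : T ⟶ W) :
    D.desc h f g ≫ t = D.desc h (f ≫ t) (g ≫ t) := by
  refine D.hom_ext_coprod h ?_ ?_
  · rw [← Category.assoc, inl_desc, inl_desc]
  · rw [← Category.assoc, inr_desc, inr_desc]

theorem conv_eq {T : X.PointedOver} (f g : D.obj ⟶ T) :
    D.conv h f g = D.comul ≫ D.desc h f g :=
  rfl

/-- On both sides a function is determined by its restrictions to the two copies, and every
compatible pair of restrictions occurs on `Nil_X(F ⊕ F)`. Injectivity uses the first fact for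
`Nil_X(F ⊕ F)`, surjectivity uses it for `Y ⨿_X Y`. -/
theorem isIso_desc_nilPointedMap [IsAffineHom D.obj.toBase] [IsAffineHom D.coprod.toBase]
    {F : X.Modules} [F.IsQuasicoherent] (e : D.obj ≅ F.nilPointed) :
    IsIso (D.desc h (e.hom ≫ nilPointedMap (biprod.fst : F ⊞ F ⟶ F))
      (e.hom ≫ nilPointedMap biprod.snd)) := by
  set κ := D.desc h (e.hom ≫ nilPointedMap (biprod.fst : F ⊞ F ⟶ F))
      (e.hom ≫ nilPointedMap biprod.snd) with hκ
  have hl : D.inl ≫ κ = e.hom ≫ nilPointedMap (biprod.fst : F ⊞ F ⟶ F) := inl_desc ..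
  have hr : D.inr ≫ κ = e.hom ≫ nilPointedMap (biprod.snd : F ⊞ F ⟶ F) := inr_desc ..
  refine isIso_of_pull_bijective κ fun U ↦ ⟨?_, fun z ↦ ?_⟩
  · refine (injective_iff_map_eq_zero (pull κ U.toOpens).hom).mpr fun w hw ↦ ?_
    replace hw : pull κ U.toOpens w = 0 := hw
    have he {a : F.nilPointed.sections U.toOpens} (ha : pull e.hom U.toOpens a = 0) : a = 0 := by
      rw [← pull_id_apply _ _ a, ← e.inv_hom_id, pull_comp_apply, ha, map_zero]
    refine eq_zero_of_pull_fst_of_pull_snd F U (he ?_) (he ?_)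
    · rw [← pull_comp_apply, ← hl, pull_comp_apply, hw, map_zero]
    · rw [← pull_comp_apply, ← hr, pull_comp_apply, hw, map_zero]
  · obtain ⟨w, h₁, h₂⟩ := exists_pull_fst_eq_and_pull_snd_eq F U
      (a := pull e.inv U.toOpens (pull D.inl U.toOpens z))
      (b := pull e.inv U.toOpens (pull D.inr U.toOpens z)) (by simp)
    refine ⟨w, sub_eq_zero.mp (eq_zero_of_isColimit h U ?_ ?_)⟩
    · rw [map_sub, ← pull_comp_apply, hl, pull_comp_apply, h₁, ← pull_comp_apply, e.hom_inv_id,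
        pull_id_apply, sub_self]
    · rw [map_sub, ← pull_comp_apply, hr, pull_comp_apply, h₂, ← pull_comp_apply, e.hom_inv_id,
        pull_id_apply, sub_self]

/-- An isomorphism from a cogroup object to `Nil_X(F)` is automatically compatible with the
cogroup structures. -/
theorem nonempty_cogroupIso [IsAffineHom D.obj.toBase] [IsAffineHom D.coprod.toBase]
    (hassoc : ∀ {T : X.PointedOver} (f g k : D.obj ⟶ T),
      D.conv h (D.conv h f g) k = D.conv h f (D.conv h g k))
    (hcounit : ∀ {T : X.PointedOver} (f : D.obj ⟶ T), D.conv h (D.obj.trivialHom T) f = f ∧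
      D.conv h f (D.obj.trivialHom T) = f)
    (hinv : ∀ {T : X.PointedOver} (f : D.obj ⟶ T), D.conv h (D.inv ≫ f) f = D.obj.trivialHom T)
    {F : X.Modules} [F.IsQuasicoherent] (e : D.obj ≅ F.nilPointed) :
    Nonempty (D.CogroupIso F.nilCogroup) := by
  set κ : D.coprod ⟶ (F ⊞ F).nilPointed := D.desc h
    (e.hom ≫ nilPointedMap (biprod.fst : F ⊞ F ⟶ F)) (e.hom ≫ nilPointedMap biprod.snd)
  have hκ : IsIso κ := D.isIso_desc_nilPointedMap h e
  have hκ_comp (φ : F ⟶ F ⊞ F) : κ ≫ nilPointedMap φ = D.desc h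
      (e.hom ≫ nilPointedMap (φ ≫ biprod.fst)) (e.hom ≫ nilPointedMap (φ ≫ biprod.snd)) := by
    rw [desc_comp, Category.assoc, Category.assoc, nilPointedMap_comp, nilPointedMap_comp]
  have hcomul : D.comul ≫ κ = e.hom ≫ nilPointedMap (biprod.fst + biprod.snd) := by
    -- Composing `κ` with this projection gives `[e, trivial]`, so the counit law computes the
    -- component; `h₂` is the mirror case.
    have h₁ : (D.comul ≫ κ) ≫ nilPointedMap (biprod.inl : F ⟶ F ⊞ F) = e.hom := by
      rw [Category.assoc, hκ_comp, biprod.inl_fst, biprod.inl_snd, nilPointedMap_id,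
        Category.comp_id, nilPointedMap_zero, comp_trivialHom]
      exact (hcounit e.hom).2
    have h₂ : (D.comul ≫ κ) ≫ nilPointedMap (biprod.inr : F ⟶ F ⊞ F) = e.hom := by
      rw [Category.assoc, hκ_comp, biprod.inr_fst, biprod.inr_snd, nilPointedMap_id,
        Category.comp_id, nilPointedMap_zero, comp_trivialHom]
      exact (hcounit e.hom).1
    have h₃ : (e.hom ≫ nilPointedMap (biprod.fst + biprod.snd)) ≫
        nilPointedMap (biprod.inl : F ⟶ F ⊞ F) = e.hom := by
      rw [Category.assoc, ← nilPointedMap_comp, Preadditive.comp_add, biprod.inl_fst,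
        biprod.inl_snd, add_zero, nilPointedMap_id, Category.comp_id]
    have h₄ : (e.hom ≫ nilPointedMap (biprod.fst + biprod.snd)) ≫
        nilPointedMap (biprod.inr : F ⟶ F ⊞ F) = e.hom := by
      rw [Category.assoc, ← nilPointedMap_comp, Preadditive.comp_add, biprod.inr_fst,
        biprod.inr_snd, zero_add, nilPointedMap_id, Category.comp_id]
    refine hom_ext_pull fun U ↦ ?_
    ext w
    obtain ⟨a, b, rfl⟩ := exists_eq_pull_inl_add_pull_inr F U w
    change pull _ U.toOpens _ = pull _ U.toOpens _
    rw [map_add, map_add, ← pull_comp_apply, ← pull_comp_apply, ← pull_comp_apply,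
      ← pull_comp_apply, h₁, h₂, h₃, h₄]
  have hinv' : D.conv h e.hom (e.hom ≫ nilPointedMap (-𝟙 F)) = D.obj.trivialHom _ := by
    -- The map `(1, -1) : F → F ⊕ F` followed by addition is zero, which shows that `-1` gives a
    -- right inverse of `e` for the transported law.
    have := hκ_comp (biprod.lift (𝟙 F) (-𝟙 F))
    rw [biprod.lift_fst, biprod.lift_snd, nilPointedMap_id, Category.comp_id] at this
    rw [conv_eq, ← this, ← Category.assoc, hcomul, Category.assoc, ← nilPointedMap_comp,
      Preadditive.comp_add, biprod.lift_fst, biprod.lift_snd, add_neg_cancel, nilPointedMap_zero,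
      comp_trivialHom]
  refine ⟨⟨e, @asIso _ _ _ _ κ hκ, D.inl_desc h _ _, D.inr_desc h _ _, hcomul, ?_⟩⟩
  -- A left inverse and a right inverse of the same element coincide.
  calc D.inv ≫ e.hom
      = D.conv h (D.inv ≫ e.hom) (D.conv h e.hom (e.hom ≫ nilPointedMap (-𝟙 F))) := by
        rw [hinv', (hcounit _).2]
    _ = e.hom ≫ nilPointedMap (-𝟙 F) := by
        rw [← hassoc, hinv, (hcounit _).1]

end CogroupData

/-! ### Uniqueness of the module and the main theorem. -/

/-- Isomorphisms `Nil_X(G) ≅ Nil_X(F)` in `X/Sch_X` come from unique isomorphisms `F ≅ G`. -/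
theorem Modules.existsUnique_iso_nilPointedMap_eq {F G : X.Modules} [F.IsQuasicoherent]
    [G.IsQuasicoherent] (t : G.nilPointed ≅ F.nilPointed) :
    ∃! φ : F ≅ G, nilPointedMap φ.hom = t.hom := by
  obtain ⟨φ, hφ⟩ := exists_nilPointedMap_eq t.hom
  obtain ⟨ψ, hψ⟩ := exists_nilPointedMap_eq t.inv
  refine ⟨⟨φ, ψ, nilPointedMap_injective ?_, nilPointedMap_injective ?_⟩, hφ, fun χ hχ ↦ ?_⟩
  · rw [nilPointedMap_comp, hφ, hψ, t.inv_hom_id, nilPointedMap_id]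
  · rw [nilPointedMap_comp, hφ, hψ, t.hom_inv_id, nilPointedMap_id]
  · exact Iso.ext (nilPointedMap_injective (hχ.trans hφ.symm))

end AlgebraicGeometry.Scheme

end

theorem mainTheorem6 {X : Scheme.{u}} (D : Scheme.CogroupData X) (hD : D.IsCogroup)
    (hset : IsPushout (Scheme.forget.map D.obj.sec) (Scheme.forget.map D.obj.sec)
      (Scheme.forget.map (Scheme.PointedOver.schemeHom D.inl))
      (Scheme.forget.map (Scheme.PointedOver.schemeHom D.inr))) :
    (∃ (F : X.Modules) (_ : F.IsQuasicoherent), Nonempty (D.CogroupIso F.nilCogroup)) ∧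
    (∀ (F G : X.Modules) [F.IsQuasicoherent] [G.IsQuasicoherent]
      (e : D.CogroupIso F.nilCogroup) (e' : D.CogroupIso G.nilCogroup),
      ∃! φ : F ≅ G, e'.obj.hom ≫ Scheme.Modules.nilPointedMap φ.hom = e.obj.hom) ∧
    IsHomeomorph D.obj.toBase ∧
    IsAffineHom D.obj.toBase ∧
    (∀ (U : X.Opens) (a b : Γ(D.obj.scheme, D.obj.toBase ⁻¹ᵁ U)),
      D.obj.sec.app (D.obj.toBase ⁻¹ᵁ U) a = 0 → D.obj.sec.app (D.obj.toBase ⁻¹ᵁ U) b = 0 →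
        a * b = 0) := by
  obtain ⟨h, hgroup⟩ := hD
  have hset' (z : D.coprod.scheme) : (∃ y, Scheme.PointedOver.schemeHom D.inl y = z) ∨
      ∃ y, Scheme.PointedOver.schemeHom D.inr y = z :=
    -- Only joint surjectivity of the two inclusions is extracted from the set-theoretic pushout.
    Types.eq_or_eq_of_isPushout hset z
  have hsec := D.surjective_sec h (fun {T} ↦ (hgroup T).2.1) hset'
  have haff := D.obj.isAffineHom_toBase hsec
  have haff' := D.coprod.isAffineHom_toBase (D.surjective_sec_coprod hsec hset')
  have hmul (U : X.Opens) (a b : D.obj.sections U) (ha : D.obj.aug U a = 0)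
      (hb : D.obj.aug U b = 0) : a * b = 0 :=
    D.mul_eq_zero_of_aug_eq_zero h (fun {T} ↦ (hgroup T).2.1) U ha hb
  refine ⟨?_, fun F G _ _ e e' ↦ ?_, D.obj.isHomeomorph_toBase hsec, haff, fun U a b ha hb ↦ ?_⟩
  · obtain ⟨e⟩ := D.obj.nonempty_iso_nilPointed hmul
    exact ⟨_, inferInstance, D.nonempty_cogroupIso h (fun {T} ↦ (hgroup T).1)
      (fun {T} ↦ (hgroup T).2.1) (fun {T} f ↦ ((hgroup T).2.2 f).1) e⟩
  · have (φ : F ≅ G) : e'.obj.hom ≫ Scheme.Modules.nilPointedMap φ.hom = e.obj.hom ↔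
        Scheme.Modules.nilPointedMap φ.hom = (e'.obj.symm ≪≫ e.obj).hom :=
      (Iso.eq_inv_comp e'.obj).symm
    simp only [this]
    exact Scheme.Modules.existsUnique_iso_nilPointedMap_eq _
  -- `aug` is `sec.app` followed by restriction along the inclusion of `U` in `σ⁻¹ (p⁻¹ U)`.
  · have key {c : D.obj.sections U} (hc : D.obj.sec.app (D.obj.toBase ⁻¹ᵁ U) c = 0) :
        D.obj.aug U c = 0 :=
      (congrArg (X.presheaf.map _) hc).trans (map_zero (X.presheaf.map _).hom)
    exact hmul U a b (key ha) (key hb)
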